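/- Consider a status update system with a data buffer that stores at most $K\ge 1$ status packets and a battery that stores at most $B\ge 1$ energy packets. Status packets arrive according to a Poisson process of rate $\lambda=r\theta$ and energy packets according to an independent Poisson process of rate $r$, where $\lambda,r>0$ and $\theta\neq 1$ (in particular, the case $\lambda<r$ is covered). An arriving status packet joins the end of the buffer if fewer than $K$ status packets are waiting there and is blocked otherwise; an arriving energy packet is stored if the battery holds fewer than $B$ energy packets and is discarded otherwise. The discipline is first-come-first-served and the service time is negligible: whenever the buffer and the battery are both non-empty, the oldest waiting status packet is delivered instantly, using one energy packet. At time $0$ the system is in an arbitrary state within the capacities in which at least one of the two queues is empty, the waiting packets being ordered by their generation times, which are distinct and at most $0$, and no packet having been received yet. A valid update is a delivered status packet that, upon its reception, is more recent than all the packets received before. Let $N(t)$ be the number of valid updates delivered up to time $t$. Then, almost surely, the rate of valid updates is $$\tilde\lambda_{\mathrm{FCFS}}=\lim_{t\to\infty}\frac{N(t)}{t}=\lambda\,\frac{1-\theta^{K+B}}{1-\theta^{K+B+1}},$$ and it equals the throughput: the number of status packets delivered up to time $t$, and the number of status packets admitted to the buffer up to time $t$, divided by $t$, almost surely converge to the same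 limit. -/

import Mathlib

open MeasureTheory ProbabilityTheory Filter Topology

namespace StatusUpdate

noncomputable section

/-! ### Poisson processes, given by their arrival times -/

/-- The time between the arrivals number `n - 1` and `n`; for `n = 0` the time from the
origin to the first arrival. -/
def gap {Ω : Type*} (T : ℕ → Ω → ℝ) : ℕ → Ω → ℝ
  | 0 => T 0
  | n + 1 => fun ω => T (n + 1) ω - T n ω

/-- `T 0, T 1, …` are the arrival times of a Poisson process of the given rate on `[0, ∞)`:
the inter-arrival times are independent and exponentially distributed with that rate. -/
structure IsPoissonArrivals {Ω : Type*} [MeasurableSpace Ω] (P : Measure Ω) (rate : ℝ)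
    (T : ℕ → Ω → ℝ) : Prop where
  measurable : ∀ n, Measurable (T n)
  law_gap : ∀ n, P.map (gap T n) = expMeasure rate
  indep_gap : iIndepFun (gap T) P

/-! ### The queueing system with a data buffer and a battery -/

/-- The state of the system. -/
structure SystemState where
  /-- generation times of the status packets waiting in the data buffer,
  the head being the packet that came first -/
  buffer : List ℝ
  /-- number of energy packets stored in the battery -/
  battery : ℕ
  /-- generation times of the status packets received so far, the head being the last one
  received -/
  received : List ℝ

/-- Service in negligible time: when a status packet and an energy packet are both present,
the status packet at the front of the buffer is delivered at once and one energy packet is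
used. Immediately before an arrival one of the two queues is empty, so
at most one packet can be served after an arrival. -/
def serve (x : SystemState) : SystemState :=
  match x.buffer, x.battery with
  | g :: rest, b + 1 => ⟨rest, b, g :: x.received⟩
  | _, _ => x

/-- A status packet generated at time `t` joins the end of the buffer if fewer than `K` status
packets are waiting, and is blocked otherwise. -/
def statusArrival (K : ℕ) (t : ℝ) (x : SystemState) : SystemState :=
  serve (if x.buffer.length < K then { x with buffer := x.buffer ++ [t] } else x)

/-- An energy packet is stored if the battery holds fewer than `B` energy packets, and is
discarded otherwise. -/
def energyArrival (B : ℕ) (x : SystemState) : SystemState :=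
  serve (if x.battery < B then { x with battery := x.battery + 1 } else x)

/-- The states in which the system may be at time `0`: capacities are respected, at least one
of the two queues is empty, the waiting packets are in the order of their generation and were
generated no later than time `0`, and the record of receptions starts empty. -/
structure IsStart (K B : ℕ) (x : SystemState) : Prop where
  buffer_le : x.buffer.length ≤ K
  battery_le : x.battery ≤ B
  one_empty : x.buffer = [] ∨ x.battery = 0
  ordered : x.buffer.Pairwise (· < ·)
  past : ∀ g ∈ x.buffer, g ≤ 0
  received_nil : x.received = []

/-! ### Sample paths: all arrivals, of both kinds, are handled in the order of time.
Here `s i` and `e j` are the arrival times of the status and of the energy packets. -/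

/-- The numbers of status arrivals and of energy arrivals among the first `n` arrivals. -/
def counts (s e : ℕ → ℝ) : ℕ → ℕ × ℕ
  | 0 => (0, 0)
  | n + 1 =>
    let c := counts s e n
    if s c.1 ≤ e c.2 then (c.1 + 1, c.2) else (c.1, c.2 + 1)

/-- Arrival number `n` (counted from `0`) is that of a status packet. -/
def IsStatus (s e : ℕ → ℝ) (n : ℕ) : Prop :=
  s (counts s e n).1 ≤ e (counts s e n).2

/-- The time of arrival number `n`. -/
def eventTime (s e : ℕ → ℝ) (n : ℕ) : ℝ :=
  min (s (counts s e n).1) (e (counts s e n).2)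

open Classical in
/-- The state of the system immediately before arrival number `n`, when it is started in `x₀`. -/
def state (K B : ℕ) (x₀ : SystemState) (s e : ℕ → ℝ) : ℕ → SystemState
  | 0 => x₀
  | n + 1 =>
    if IsStatus s e n then statusArrival K (eventTime s e n) (state K B x₀ s e n)
    else energyArrival B (state K B x₀ s e n)

/-- At arrival number `n`, the packet with generation time `g` is delivered. -/
def Delivers (K B : ℕ) (x₀ : SystemState) (s e : ℕ → ℝ) (n : ℕ) (g : ℝ) : Prop :=
  (state K B x₀ s e (n + 1)).received = g :: (state K B x₀ s e n).received

/-- The number of valid updates delivered up to time `t`: packets that, upon their reception,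
are more recent than every packet received before. -/
def validCount (K B : ℕ) (x₀ : SystemState) (s e : ℕ → ℝ) (t : ℝ) : ℕ :=
  {n : ℕ | eventTime s e n ≤ t ∧ ∃ g, Delivers K B x₀ s e n g ∧
    ∀ h ∈ (state K B x₀ s e n).received, h < g}.ncard

/-- The number of status packets delivered up to time `t`. -/
def deliveredCount (K B : ℕ) (x₀ : SystemState) (s e : ℕ → ℝ) (t : ℝ) : ℕ :=
  {n : ℕ | eventTime s e n ≤ t ∧ ∃ g, Delivers K B x₀ s e n g}.ncard

/-- The number of status packets admitted to the data buffer up to time `t`. -/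
def admittedCount (K B : ℕ) (x₀ : SystemState) (s e : ℕ → ℝ) (t : ℝ) : ℕ :=
  {n : ℕ | eventTime s e n ≤ t ∧ IsStatus s e n ∧
    (state K B x₀ s e n).buffer.length < K}.ncard

/-- The sample path of a counting process `N` has the long-run rate `ρ`. -/
def HasRate (N : ℝ → ℕ) (ρ : ℝ) : Prop :=
  Tendsto (fun t : ℝ => (N t : ℝ) / t) atTop (𝓝 ρ)

end

end StatusUpdate

/-! Service in order of arrival keeps the received packets, followed by the waiting ones, in
increasing order of generation (`ordered_state`), so every delivery is a valid update. Admissions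
and deliveries differ only by the change of the buffer content, which is bounded by `K`. Hence all
three rates equal the rate of admissions.

The battery content plus the free places of the buffer is a walk on `{0, …, K + B}`, and an arriving
status packet is blocked exactly when the walk is at `0`. By the lack of memory of the exponential
law, the residual waiting times after an arrival have the original joint law and are independent of
the kind of that arrival (`gapLaw_firstKind_inter`). Iterating this, the kinds of successive
arrivals are i.i.d., a status packet having probability `p = lam / (lam + r)`.

The frequencies of the levels come from a pathwise argument. The flow across each edge of the walk
balances up to an error of at most one (`visits_flow`), and the down-steps from a level differ from
`p` times the visits to it by a martingale that is almost surely `o(n)` (`ae_tendsto_excess_div`).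
The visit frequencies are thus geometric in the limit, with ratio `(1 - p) / p = θ⁻¹`, and they sum
to one. With `m = K + B`, down-steps from positive levels have frequency `p * (1 - θ ^ m) / (1 - θ ^
(m + 1))`. Since the arrival epochs grow like `n / (lam + r)`, `hasRate_ncard` turns this frequency
per arrival into the rate per unit of time. -/

namespace StatusUpdate

/-! ### The queueing system along a sample path -/

/-- The walk on `{0, …, m}` that goes down at a status arrival (`β n = true`) and up at an
energy arrival. -/
def level (m z₀ : ℕ) (β : ℕ → Bool) : ℕ → ℕ
  | 0 => z₀
  | n + 1 => if β n then level m z₀ β n - 1 else min (level m z₀ β n + 1) m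

open Classical in
/-- The kind of arrival number `n`, as a Boolean. -/
noncomputable def kind (s e : ℕ → ℝ) (n : ℕ) : Bool := decide (IsStatus s e n)

lemma kind_eq_true {s e : ℕ → ℝ} {n : ℕ} : kind s e n = true ↔ IsStatus s e n := by
  simp [kind]

/-- The capacities are respected, and one of the two queues is empty. -/
structure Feasible (K B : ℕ) (x : SystemState) : Prop where
  buffer_le : x.buffer.length ≤ K
  battery_le : x.battery ≤ B
  one_empty : x.buffer = [] ∨ x.battery = 0

lemma statusArrival_cases {K B : ℕ} (hK : 1 ≤ K) {x : SystemState} (hx : Feasible K B x) (t : ℝ) :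
    (x.buffer.length < K ∧ x.battery = 0 ∧ statusArrival K t x = ⟨x.buffer ++ [t], 0, x.received⟩) ∨
    (x.buffer.length < K ∧ x.buffer = [] ∧ ∃ b, x.battery = b + 1 ∧
      statusArrival K t x = ⟨[], b, t :: x.received⟩) ∨
    (x.buffer.length = K ∧ x.battery = 0 ∧ statusArrival K t x = x) := by
  obtain ⟨buf, bat, rec⟩ := x
  obtain ⟨h1, h2, h3⟩ := hx
  simp only at h1 h2 h3
  rcases Nat.lt_or_ge buf.length K with h | h
  · rcases bat with _ | b
    · left
      simp only [statusArrival, h, if_true, true_and]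
      rcases buf with _ | ⟨g, rest⟩ <;> rfl
    · have hb : buf = [] := by simpa using h3
      subst hb
      right; left
      refine ⟨h, rfl, b, rfl, ?_⟩
      simp only [statusArrival, h, if_true]
      rfl
  · right; right
    rcases buf with _ | ⟨g, rest⟩
    -- An empty buffer is not full, since `K ≥ 1`.
    · simp at h; omega
    · have hb : bat = 0 := by simpa using h3
      subst hb
      refine ⟨le_antisymm h1 h, rfl, ?_⟩
      simp only [statusArrival, if_neg (not_lt.2 h)]
      rfl

lemma energyArrival_cases {K B : ℕ} (hB : 1 ≤ B) {x : SystemState} (hx : Feasible K B x) :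
    (x.buffer = [] ∧ x.battery = B ∧ energyArrival B x = x) ∨
    (x.buffer = [] ∧ x.battery < B ∧ energyArrival B x = ⟨[], x.battery + 1, x.received⟩) ∨
    (x.battery = 0 ∧ ∃ g rest, x.buffer = g :: rest ∧
      energyArrival B x = ⟨rest, 0, g :: x.received⟩) := by
  obtain ⟨buf, bat, rec⟩ := x
  obtain ⟨h1, h2, h3⟩ := hx
  simp only at h1 h2 h3
  rcases buf with _ | ⟨g, rest⟩
  · rcases Nat.lt_or_ge bat B with h | h
    · right; left
      refine ⟨rfl, h, ?_⟩
      simp only [energyArrival, h, if_true]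
      rfl
    · left
      refine ⟨rfl, le_antisymm h2 h, ?_⟩
      simp only [energyArrival, if_neg (not_lt.2 h)]
      rfl
  · have hb : bat = 0 := by simpa using h3
    subst hb
    right; right
    refine ⟨rfl, g, rest, rfl, ?_⟩
    -- A waiting packet means an empty battery; `B ≥ 1` lets the energy packet in, and it is used at
    -- once.
    simp only [energyArrival, if_pos (show 0 < B by omega)]
    rfl

lemma Feasible.statusArrival {K B : ℕ} (hK : 1 ≤ K) {x : SystemState} (hx : Feasible K B x)
    (t : ℝ) : Feasible K B (statusArrival K t x) := by
  rcases statusArrival_cases hK hx t with ⟨h, _, h'⟩ | ⟨h, _, b, hb, h'⟩ | ⟨_, _, h'⟩ <;> rw [h']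
  · exact ⟨by simpa using h, Nat.zero_le _, Or.inr rfl⟩
  · exact ⟨Nat.zero_le _, by have := hx.battery_le; simp only; omega, Or.inl rfl⟩
  · exact hx

lemma Feasible.energyArrival {K B : ℕ} (hB : 1 ≤ B) {x : SystemState} (hx : Feasible K B x) :
    Feasible K B (energyArrival B x) := by
  rcases energyArrival_cases hB hx with ⟨_, _, h'⟩ | ⟨_, h, h'⟩ | ⟨_, g, rest, h, h'⟩ <;> rw [h']
  · exact hx
  · exact ⟨Nat.zero_le _, h, Or.inl rfl⟩
  · refine ⟨?_, Nat.zero_le _, Or.inr rfl⟩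
    have := hx.buffer_le
    rw [h] at this
    simp only [List.length_cons] at this ⊢
    omega

section Path

variable {K B : ℕ} {x₀ : SystemState} {s e : ℕ → ℝ}

lemma state_succ_of_isStatus {n : ℕ} (h : IsStatus s e n) :
    state K B x₀ s e (n + 1) = statusArrival K (eventTime s e n) (state K B x₀ s e n) := by
  simp only [state, h, if_true]

lemma state_succ_of_not_isStatus {n : ℕ} (h : ¬ IsStatus s e n) :
    state K B x₀ s e (n + 1) = energyArrival B (state K B x₀ s e n) := by
  simp only [state, h, if_false]

lemma feasible_state (hK : 1 ≤ K) (hB : 1 ≤ B) (hx₀ : IsStart K B x₀) (n : ℕ) :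
    Feasible K B (state K B x₀ s e n) := by
  induction n with
  | zero => exact ⟨hx₀.buffer_le, hx₀.battery_le, hx₀.one_empty⟩
  | succ n ih =>
    by_cases h : IsStatus s e n
    · rw [state_succ_of_isStatus h]; exact ih.statusArrival hK _
    · rw [state_succ_of_not_isStatus h]; exact ih.energyArrival hB

/-- The battery content and the free places of the buffer, taken together, perform the walk
`level`. -/
lemma battery_add_eq_level_add (hK : 1 ≤ K) (hB : 1 ≤ B) (hx₀ : IsStart K B x₀) (n : ℕ) :
    (state K B x₀ s e n).battery + K =
      level (K + B) (x₀.battery + K - x₀.buffer.length) (kind s e) n +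
        (state K B x₀ s e n).buffer.length := by
  induction n with
  | zero => have := hx₀.buffer_le; simp only [state, level]; omega
  | succ n ih =>
    have hf := feasible_state (s := s) (e := e) hK hB hx₀ n
    have h1 := hf.buffer_le
    have h2 := hf.battery_le
    by_cases h : IsStatus s e n
    · rw [state_succ_of_isStatus h, level, if_pos (kind_eq_true.2 h)]
      rcases statusArrival_cases hK hf (eventTime s e n) with
        ⟨h, hb, h'⟩ | ⟨h, hb, b, hb', h'⟩ | ⟨h, hb, h'⟩ <;> rw [h']
      · simp only [List.length_append, List.length_singleton]; omega
      · rw [hb] at ih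
        simp only [List.length_nil] at ih ⊢; omega
      · omega
    · rw [state_succ_of_not_isStatus h, level, if_neg (mt kind_eq_true.1 h)]
      rcases energyArrival_cases hB hf with ⟨hb, h, h'⟩ | ⟨hb, h, h'⟩ | ⟨hb, g, rest, h, h'⟩ <;>
        rw [h']
      · rw [hb] at ih ⊢
        simp only [List.length_nil] at ih ⊢; omega
      · rw [hb] at ih
        simp only [List.length_nil] at ih ⊢; omega
      · rw [h] at ih h1
        simp only [List.length_cons] at ih h1 ⊢; omega

/-- The walk is at `0` only if the battery is empty and no place is free; conversely a full buffer
is non-empty, so it forces an empty battery. Admissions are thereby the down-steps from positive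
levels. -/
lemma buffer_length_lt_iff (hK : 1 ≤ K) (hB : 1 ≤ B) (hx₀ : IsStart K B x₀) (n : ℕ) :
    (state K B x₀ s e n).buffer.length < K ↔
      level (K + B) (x₀.battery + K - x₀.buffer.length) (kind s e) n ≠ 0 := by
  have hf := feasible_state (s := s) (e := e) hK hB hx₀ n
  have h := battery_add_eq_level_add (s := s) (e := e) hK hB hx₀ n
  have h1 := hf.buffer_le
  rcases hf.one_empty with h3 | h3
  · rw [h3] at h ⊢
    simp only [List.length_nil] at h ⊢; omega
  · omega

/-- At each arrival the number of packets waiting or received goes up by one if a packet is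
admitted and is unchanged otherwise, and at most one packet is delivered. -/
lemma state_succ_cases (hK : 1 ≤ K) (hB : 1 ≤ B) (hx₀ : IsStart K B x₀) (n : ℕ) :
    ((state K B x₀ s e (n + 1)).received = (state K B x₀ s e n).received ∨
      ∃ g, Delivers K B x₀ s e n g) ∧
    ((IsStatus s e n ∧ (state K B x₀ s e n).buffer.length < K ∧
      (state K B x₀ s e (n + 1)).received.reverse ++ (state K B x₀ s e (n + 1)).buffer =
        ((state K B x₀ s e n).received.reverse ++ (state K B x₀ s e n).buffer) ++
          [eventTime s e n]) ∨
      (¬ (IsStatus s e n ∧ (state K B x₀ s e n).buffer.length < K) ∧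
      (state K B x₀ s e (n + 1)).received.reverse ++ (state K B x₀ s e (n + 1)).buffer =
        (state K B x₀ s e n).received.reverse ++ (state K B x₀ s e n).buffer)) := by
  have hf := feasible_state (s := s) (e := e) hK hB hx₀ n
  unfold Delivers
  by_cases hs : IsStatus s e n
  · rw [state_succ_of_isStatus hs]
    rcases statusArrival_cases hK hf (eventTime s e n) with
      ⟨h, hb, h'⟩ | ⟨h, hb, b, hb', h'⟩ | ⟨h, hb, h'⟩ <;> rw [h']
    · simp [hs, h]
    · simp [hs, hb, show 0 < K by omega]
    · simp [h]
  · rw [state_succ_of_not_isStatus hs]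
    rcases energyArrival_cases hB hf with ⟨hb, h, h'⟩ | ⟨hb, h, h'⟩ | ⟨hb, g, rest, h, h'⟩ <;>
      rw [h']
    · simp [hs]
    · simp [hs, hb]
    · simp [hs, h]

open Classical in
lemma received_length_eq_count (hK : 1 ≤ K) (hB : 1 ≤ B) (hx₀ : IsStart K B x₀) (n : ℕ) :
    (state K B x₀ s e n).received.length =
      Nat.count (fun k => ∃ g, Delivers K B x₀ s e k g) n := by
  induction n with
  | zero => simp [state, hx₀.received_nil]
  | succ n ih =>
    rw [Nat.count_succ, ← ih]
    rcases (state_succ_cases (s := s) (e := e) hK hB hx₀ n).1 with h | ⟨g, h⟩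
    · rw [if_neg, h, add_zero]
      rintro ⟨g, hg⟩
      rw [Delivers, h] at hg
      simpa using congrArg List.length hg
    · rw [if_pos ⟨g, h⟩, h, List.length_cons]

open Classical in
-- Conservation of packets. As the buffer content is bounded, it forces admissions and deliveries to
-- have the same frequency.
lemma waiting_add_received_eq_count (hK : 1 ≤ K) (hB : 1 ≤ B) (hx₀ : IsStart K B x₀) (n : ℕ) :
    (state K B x₀ s e n).received.length + (state K B x₀ s e n).buffer.length =
      x₀.buffer.length +
        Nat.count (fun k => IsStatus s e k ∧ (state K B x₀ s e k).buffer.length < K) n := by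
  induction n with
  | zero => simp [state, hx₀.received_nil]
  | succ n ih =>
    rw [Nat.count_succ]
    rcases (state_succ_cases (s := s) (e := e) hK hB hx₀ n).2 with ⟨h, h', h''⟩ | ⟨h, h''⟩
    · have := congrArg List.length h''
      simp only [List.length_append, List.length_reverse, List.length_singleton] at this
      rw [if_pos ⟨h, h'⟩]; omega
    · have := congrArg List.length h''
      simp only [List.length_append, List.length_reverse] at this
      rw [if_neg h]; omega

/-- All packets received or waiting are in the order of their generation, and older than the
next status packet to arrive. -/
lemma ordered_state (hK : 1 ≤ K) (hB : 1 ≤ B) (hx₀ : IsStart K B x₀) (hs : StrictMono s)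
    (hs0 : 0 < s 0) (n : ℕ) :
    ((state K B x₀ s e n).received.reverse ++ (state K B x₀ s e n).buffer).Pairwise (· < ·) ∧
      ∀ g ∈ (state K B x₀ s e n).received.reverse ++ (state K B x₀ s e n).buffer,
        g < s (counts s e n).1 := by
  induction n with
  | zero =>
    simp only [state, counts, hx₀.received_nil, List.reverse_nil, List.nil_append]
    exact ⟨hx₀.ordered, fun g hg => (hx₀.past g hg).trans_lt hs0⟩
  | succ n ih =>
    have hle : s (counts s e n).1 ≤ s (counts s e (n + 1)).1 := by
      apply hs.monotone
      simp only [counts]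
      split_ifs <;> simp
    rcases (state_succ_cases (s := s) (e := e) hK hB hx₀ n).2 with ⟨h, h', h''⟩ | ⟨h, h''⟩
    · have ht : eventTime s e n = s (counts s e n).1 := min_eq_left h
      have hlt : s (counts s e n).1 < s (counts s e (n + 1)).1 := by
        apply hs
        simp only [counts]
        rw [if_pos (show s (counts s e n).1 ≤ e (counts s e n).2 from h)]
        simp
      rw [h'', ht]
      refine ⟨List.pairwise_append.2 ⟨ih.1, List.pairwise_singleton _ _, ?_⟩, ?_⟩
      · intro a ha b hb
        rw [List.mem_singleton] at hb
        exact hb ▸ ih.2 a ha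
      · intro g hg
        rcases List.mem_append.1 hg with hg | hg
        · exact (ih.2 g hg).trans_le hle
        · rw [List.mem_singleton] at hg
          exact hg ▸ hlt
    · rw [h'']
      exact ⟨ih.1, fun g hg => (ih.2 g hg).trans_le hle⟩

/-- Under the first-come-first-served discipline every delivery is a valid update. -/
lemma validCount_eq_deliveredCount (hK : 1 ≤ K) (hB : 1 ≤ B) (hx₀ : IsStart K B x₀)
    (hs : StrictMono s) (hs0 : 0 < s 0) :
    validCount K B x₀ s e = deliveredCount K B x₀ s e := by
  funext t
  unfold validCount deliveredCount
  congr 1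
  ext n
  refine and_congr_right fun _ => ⟨fun ⟨g, hg, _⟩ => ⟨g, hg⟩, fun ⟨g, hg⟩ => ⟨g, hg, ?_⟩⟩
  intro h hh
  have := (List.pairwise_append.1 (ordered_state (e := e) hK hB hx₀ hs hs0 (n + 1)).1).1
  rw [hg, List.reverse_cons, List.pairwise_append] at this
  exact this.2.2 h (by simpa using hh) g (by simp)

lemma level_le {m z₀ : ℕ} (hz₀ : z₀ ≤ m) (β : ℕ → Bool) (n : ℕ) : level m z₀ β n ≤ m := by
  induction n with
  | zero => exact hz₀
  | succ n ih => rw [level]; split_ifs <;> omega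

lemma counts_fst_eq_count (n : ℕ) :
    (counts s e n).1 = Nat.count (fun k => kind s e k = true) n := by
  induction n with
  | zero => rfl
  | succ n ih =>
    rw [Nat.count_succ, ← ih, counts]
    by_cases h : IsStatus s e n
    · rw [if_pos (kind_eq_true.2 h)]
      rw [IsStatus] at h
      simp [h]
    · rw [if_neg (mt kind_eq_true.1 h)]
      rw [IsStatus] at h
      simp [h]

lemma monotone_eventTime (hs : Monotone s) (he : Monotone e) : Monotone (eventTime s e) := by
  refine monotone_nat_of_le_succ fun n => ?_
  simp only [eventTime, counts]
  apply min_le_min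
  · apply hs; split_ifs <;> simp
  · apply he; split_ifs <;> simp

/-- Status packets already counted have arrived; this bounds the epochs from below in
`tendsto_eventTime_div`. -/
lemma le_eventTime_of_lt (hs : Monotone s) (he : Monotone e) (n : ℕ) :
    ∀ k < (counts s e n).1, s k ≤ eventTime s e n := by
  induction n with
  | zero => intro k hk; simp [counts] at hk
  | succ n ih =>
    intro k hk
    by_cases h : s (counts s e n).1 ≤ e (counts s e n).2
    · rw [counts] at hk
      simp only [h, if_true] at hk
      refine le_trans (hs (Nat.lt_succ_iff.1 hk)) ?_
      refine le_trans ?_ (monotone_eventTime hs he (Nat.le_succ n))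
      rw [eventTime, min_eq_left h]
    · rw [counts] at hk
      simp only [h, if_false] at hk
      exact (ih k hk).trans (monotone_eventTime hs he (Nat.le_succ n))

end Path

/-! ### Long-run frequencies along a sequence of epochs -/

section Rate

/-- If the epochs `τ n` grow like `c * n` and the proportion of indices satisfying `p` is `α`,
then such epochs occur at the rate `α / c`. -/
lemma hasRate_ncard {τ : ℕ → ℝ} (hτ : Monotone τ) {c α : ℝ} (hc : 0 < c)
    (hτc : Tendsto (fun n : ℕ => τ n / n) atTop (𝓝 c)) {p : ℕ → Prop} [DecidablePred p]
    (hp : Tendsto (fun n : ℕ => (Nat.count p n : ℝ) / n) atTop (𝓝 α)) :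
    HasRate (fun t => {n : ℕ | τ n ≤ t ∧ p n}.ncard) (α / c) := by
  have hτtop : Tendsto τ atTop atTop := by
    have h := hτc.pos_mul_atTop hc tendsto_natCast_atTop_atTop
    refine h.congr' ?_
    filter_upwards [eventually_gt_atTop 0] with n hn
    have : (n : ℝ) ≠ 0 := by positivity
    field_simp
  have hex : ∀ t : ℝ, ∃ n, t < τ n := fun t => (hτtop.eventually_gt_atTop t).exists
  -- By monotonicity, the indices below `N t` are exactly those of the epochs up to time `t`.
  let N : ℝ → ℕ := fun t => Nat.find (hex t)
  have hN1 : ∀ t, t < τ (N t) := fun t => Nat.find_spec (hex t)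
  have hN2 : ∀ t n, n < N t → τ n ≤ t := fun t n h => not_lt.1 (Nat.find_min (hex t) h)
  have hNtop : Tendsto N atTop atTop := by
    refine tendsto_atTop.2 fun k => ?_
    filter_upwards [eventually_ge_atTop (τ k)] with t ht
    by_contra! h
    exact absurd (hN1 t) (not_lt.2 ((hτ h.le).trans ht))
  have hcount : ∀ t, {n : ℕ | τ n ≤ t ∧ p n}.ncard = Nat.count p (N t) := by
    intro t
    rw [Nat.count_eq_card_filter_range, ← Set.ncard_coe_finset]
    congr 1
    ext n
    simp only [Set.mem_ofPred_eq, Finset.coe_filter, Finset.mem_range]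
    refine and_congr_left fun _ => ⟨fun h => ?_, hN2 t n⟩
    by_contra! h'
    exact absurd (hN1 t) (not_lt.2 ((hτ h').trans h))
  -- Once `N t > 0`, one has `τ (N t - 1) ≤ t < τ (N t)`; the shifted index does not affect the
  -- limit.
  have hup : Tendsto (fun n : ℕ => τ (n - 1) / n) atTop (𝓝 c) := by
    have h1 : Tendsto (fun n : ℕ => τ (n - 1) / ((n - 1 : ℕ) : ℝ)) atTop (𝓝 c) :=
      hτc.comp (tendsto_sub_atTop_nat 1)
    have h2 : Tendsto (fun n : ℕ => 1 - 1 / (n : ℝ)) atTop (𝓝 (1 - 0)) :=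
      tendsto_const_nhds.sub tendsto_one_div_atTop_nhds_zero_nat
    have h3 := h1.mul h2
    rw [sub_zero, mul_one] at h3
    refine h3.congr' ?_
    filter_upwards [eventually_gt_atTop 1] with n hn
    have hn' : (1 : ℝ) < n := by exact_mod_cast hn
    rw [Nat.cast_sub hn.le, Nat.cast_one]
    have : (n : ℝ) - 1 ≠ 0 := by linarith
    field_simp
  have hmid : Tendsto (fun t : ℝ => t / (N t : ℝ)) atTop (𝓝 c) := by
    refine tendsto_of_tendsto_of_tendsto_of_le_of_le' (hup.comp hNtop) (hτc.comp hNtop) ?_ ?_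
    · filter_upwards [hNtop.eventually_gt_atTop 0] with t ht
      exact div_le_div_of_nonneg_right (hN2 t _ (by omega)) (Nat.cast_nonneg _)
    · exact Eventually.of_forall fun t =>
        div_le_div_of_nonneg_right (hN1 t).le (Nat.cast_nonneg _)
  unfold HasRate
  refine ((hp.comp hNtop).div hmid hc.ne').congr' ?_
  filter_upwards [hNtop.eventually_gt_atTop 0, eventually_gt_atTop 0] with t ht ht0
  have : (N t : ℝ) ≠ 0 := by positivity
  rw [hcount]
  simp only [Pi.div_apply, Function.comp]
  field_simp

end Rate

/-! ### Frequencies of the levels -/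

section Level

/-- The excess of the number of down-steps from `z` among the first `n` steps over its
compensator `p * (number of visits of z)`. -/
def excess (p : ℝ) (Z : ℕ → ℕ) (β : ℕ → Bool) (z n : ℕ) : ℝ :=
  ∑ k ∈ Finset.range n, if Z k = z then (if β k then 1 else 0) - p else 0

/-- The number of visits of `z` before time `n`. -/
def visits (Z : ℕ → ℕ) (z n : ℕ) : ℝ :=
  ∑ k ∈ Finset.range n, if Z k = z then 1 else 0

variable {m z₀ : ℕ} {β : ℕ → Bool} {p : ℝ}

/-- The terms in `z` add up to the number of up-steps from `z`, those in `z + 1` to the number of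
down-steps from `z + 1`. Crossings of this edge alternate in direction, so the two numbers differ
only by whether the path starts and ends above it. The condition `z < m` ensures that an up-step
from `z` is not truncated. -/
lemma visits_flow {z : ℕ} (hz : z < m) (n : ℕ) :
    (1 - p) * visits (level m z₀ β) z n - excess p (level m z₀ β) β z n
        + (if z < z₀ then 1 else 0) =
      p * visits (level m z₀ β) (z + 1) n + excess p (level m z₀ β) β (z + 1) n
        + (if z < level m z₀ β n then 1 else 0) := by
  induction n with
  | zero =>
    rw [show level m z₀ β 0 = z₀ from rfl]
    simp [visits, excess]
  | succ n ih =>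
    simp only [visits, excess, Finset.sum_range_succ] at ih ⊢
    have key : (1 - p) * (if level m z₀ β n = z then 1 else 0)
          - (if level m z₀ β n = z then (if β n then 1 else 0) - p else 0)
          + (if z < level m z₀ β n then 1 else 0) =
        p * (if level m z₀ β n = z + 1 then 1 else 0)
          + (if level m z₀ β n = z + 1 then (if β n then 1 else 0) - p else 0)
          + (if z < level m z₀ β (n + 1) then (1 : ℝ) else 0) := by
      rw [level]
      generalize level m z₀ β n = w
      rcases lt_trichotomy w z with h | h | h
      · have h1 : ¬ w = z := by omega
        have h2 : ¬ w = z + 1 := by omega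
        have h3 : ¬ z < w := by omega
        have h4 : ¬ z < (if β n then w - 1 else min (w + 1) m) := by split_ifs <;> omega
        simp only [h1, h2, h3, h4, if_false]; ring
      · have h2 : ¬ w = z + 1 := by omega
        have h3 : ¬ z < w := by omega
        cases β n
        · have h4 : z < min (w + 1) m := by omega
          simp [h, hz]
        · have h4 : ¬ z < w - 1 := by omega
          simp [h]
      · have h1 : ¬ w = z := by omega
        by_cases h2 : w = z + 1
        · cases β n <;> simp [h2]
          omega
        · have h4 : z < (if β n then w - 1 else min (w + 1) m) := by split_ifs <;> omega
          simp only [h, h1, h2, h4, if_false, if_true]; ring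
    linear_combination ih + key

lemma sum_visits (hz₀ : z₀ ≤ m) (n : ℕ) :
    ∑ z ∈ Finset.range (m + 1), visits (level m z₀ β) z n = n := by
  simp only [visits]
  rw [Finset.sum_comm]
  have : ∀ k ∈ Finset.range n,
      ∑ z ∈ Finset.range (m + 1), (if level m z₀ β k = z then (1 : ℝ) else 0) = 1 := by
    intro k _
    rw [Finset.sum_ite_eq, if_pos (Finset.mem_range.2 (Nat.lt_succ_of_le (level_le hz₀ β k)))]
  rw [Finset.sum_congr rfl this]
  simp

/-- Each step starts from exactly one level. The law of large numbers for the kinds thus follows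
from the one for the excesses. -/
lemma sum_excess (hz₀ : z₀ ≤ m) (n : ℕ) :
    ∑ z ∈ Finset.range (m + 1), excess p (level m z₀ β) β z n =
      (Nat.count (fun k => β k = true) n : ℝ) - p * n := by
  simp only [excess]
  rw [Finset.sum_comm]
  have : ∀ k ∈ Finset.range n,
      ∑ z ∈ Finset.range (m + 1), (if level m z₀ β k = z then (if β k then 1 else 0) - p else 0) =
        (if β k then 1 else 0) - p := by
    intro k _
    rw [Finset.sum_ite_eq, if_pos (Finset.mem_range.2 (Nat.lt_succ_of_le (level_le hz₀ β k)))]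
  rw [Finset.sum_congr rfl this, Finset.sum_sub_distrib, Nat.count_eq_card_filter_range]
  simp [mul_comm]

/-- The bracket is the number of status arrivals at level `0`, that is, of the blocked ones. -/
lemma count_down_add_excess (n : ℕ) :
    (Nat.count (fun k => β k = true ∧ level m z₀ β k ≠ 0) n : ℝ) +
      (excess p (level m z₀ β) β 0 n + p * visits (level m z₀ β) 0 n) =
      Nat.count (fun k => β k = true) n := by
  induction n with
  | zero => simp [excess, visits]
  | succ n ih =>
    simp only [visits, excess, Finset.sum_range_succ, Nat.count_succ] at ih ⊢
    push_cast
    rw [← ih]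
    by_cases h : level m z₀ β n = 0 <;> by_cases h' : β n = true <;> simp [h, h'] <;> ring

variable (hp0 : 0 < p) (hz₀ : z₀ ≤ m)
  (hex : ∀ z, Tendsto (fun n : ℕ => excess p (level m z₀ β) β z n / n) atTop (𝓝 0))

include hex hz₀ in
lemma tendsto_count_div :
    Tendsto (fun n : ℕ => (Nat.count (fun k => β k = true) n : ℝ) / n) atTop (𝓝 p) := by
  have h := tendsto_finsetSum (Finset.range (m + 1)) fun z _ => hex z
  rw [Finset.sum_const_zero] at h
  have h' := h.add_const p
  rw [zero_add] at h'
  refine h'.congr' ?_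
  filter_upwards [eventually_gt_atTop 0] with n hn
  have : (n : ℝ) ≠ 0 := by positivity
  rw [← Finset.sum_div, sum_excess hz₀]
  field_simp
  ring

include hex hp0 in
-- Divided by `n`, `visits_flow` becomes detailed balance, `(1 - p) π_z = p π_{z+1}`. It is stated
-- as a vanishing difference because the frequency of level `0` is not yet known to converge.
lemma tendsto_visits_sub {z : ℕ} (hz : z ≤ m) :
    Tendsto (fun n : ℕ => visits (level m z₀ β) z n / n
      - ((1 - p) / p) ^ z * (visits (level m z₀ β) 0 n / n)) atTop (𝓝 0) := by
  induction z with
  | zero => simp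
  | succ z ih =>
    have hb : Tendsto (fun n : ℕ => ((if z < z₀ then 1 else 0)
        - (if z < level m z₀ β n then (1 : ℝ) else 0)) / n) atTop (𝓝 0) := by
      refine squeeze_zero_norm (fun n => ?_) tendsto_one_div_atTop_nhds_zero_nat
      rw [norm_div, RCLike.norm_natCast]
      refine div_le_div_of_nonneg_right ?_ (Nat.cast_nonneg n)
      split_ifs <;> simp
    have h := ((ih (by omega)).const_mul (1 - p)).add
      (((hb.sub (hex z)).sub (hex (z + 1))))
    have h' := h.const_mul (1 / p)
    simp only [sub_zero, mul_zero, add_zero] at h'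
    refine h'.congr fun n => ?_
    have hf := visits_flow (p := p) (z₀ := z₀) (β := β) (show z < m by omega) n
    rw [pow_succ]
    have : visits (level m z₀ β) (z + 1) n = 1 / p * ((1 - p) * visits (level m z₀ β) z n
        - excess p (level m z₀ β) β z n + (if z < z₀ then 1 else 0)
        - excess p (level m z₀ β) β (z + 1) n
        - (if z < level m z₀ β n then 1 else 0)) := by
      rw [hf]; field_simp; ring
    rw [this]
    ring

include hex hp0 hz₀ in
/-- The proportion of the steps at which the walk sits at `0`. -/
lemma tendsto_visits_zero (hp1 : p < 1) :
    Tendsto (fun n : ℕ => visits (level m z₀ β) 0 n / n) atTop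
      (𝓝 (∑ z ∈ Finset.range (m + 1), ((1 - p) / p) ^ z)⁻¹) := by
  set G := ∑ z ∈ Finset.range (m + 1), ((1 - p) / p) ^ z with hG
  have hGpos : 0 < G :=
    Finset.sum_pos (fun z _ => pow_pos (div_pos (by linarith) hp0) z) ⟨0, by simp⟩
  -- Normalisation: the frequencies sum to one, so `1 - G * π_0` tends to zero.
  have h := tendsto_finsetSum (Finset.range (m + 1)) fun z hz =>
    tendsto_visits_sub hp0 hex (Nat.lt_succ_iff.1 (Finset.mem_range.1 hz))
  rw [Finset.sum_const_zero] at h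
  have h' := (h.const_sub 1).const_mul G⁻¹
  rw [sub_zero, mul_one] at h'
  refine h'.congr' ?_
  filter_upwards [eventually_gt_atTop 0] with n hn
  have hn' : (n : ℝ) ≠ 0 := by positivity
  rw [Finset.sum_sub_distrib, ← Finset.sum_div, sum_visits hz₀, ← Finset.sum_mul, ← hG]
  field_simp
  ring

include hex hp0 hz₀ in
/-- The proportion of the steps at which the walk goes down from a positive level. -/
lemma tendsto_count_down (hp1 : p < 1) :
    Tendsto (fun n : ℕ => (Nat.count (fun k => β k = true ∧ level m z₀ β k ≠ 0) n : ℝ) / n) atTop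
      (𝓝 (p * (1 - (∑ z ∈ Finset.range (m + 1), ((1 - p) / p) ^ z)⁻¹))) := by
  have h := ((tendsto_count_div hz₀ hex).sub (hex 0)).sub
    ((tendsto_visits_zero hp0 hz₀ hex hp1).const_mul p)
  rw [sub_zero, ← mul_one_sub] at h
  refine h.congr fun n => ?_
  rw [← count_down_add_excess (m := m) (z₀ := z₀) (p := p)]
  ring

end Level

/-- The probability of not being blocked, in closed form; the terms of the sum are the unnormalised
stationary weights of the levels. -/
lemma one_sub_inv_geom_sum {θ : ℝ} (hθ : 0 < θ) (hθ1 : θ ≠ 1) (m : ℕ) :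
    1 - (∑ z ∈ Finset.range (m + 1), θ⁻¹ ^ z)⁻¹ = (1 - θ ^ m) / (1 - θ ^ (m + 1)) := by
  have h1 : 1 - θ ^ (m + 1) ≠ 0 := by
    intro h
    have : θ ^ (m + 1) = 1 := by linarith
    exact hθ1 ((pow_eq_one_iff_of_nonneg hθ.le (Nat.succ_ne_zero m)).1 this)
  have h2 : θ⁻¹ ≠ 1 := by simpa using hθ1
  have h3 : θ - 1 ≠ 0 := sub_ne_zero.2 hθ1
  have h4 : θ ^ (m + 1) - 1 ≠ 0 := fun h => h1 (by linarith)
  have h6 : θ ^ m ≠ 0 := by positivity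
  have h5 : ∑ z ∈ Finset.range (m + 1), θ⁻¹ ^ z = (1 - θ ^ (m + 1)) / (θ ^ m * (1 - θ)) := by
    rw [geom_sum_eq h2, inv_pow]
    have : (1 : ℝ) - θ ≠ 0 := fun h => h3 (by linarith)
    have h7 : θ⁻¹ - 1 ≠ 0 := sub_ne_zero.2 h2
    rw [div_eq_div_iff h7 (mul_ne_zero h6 this)]
    field_simp
    ring
  rw [h5, inv_div]
  field_simp
  ring

/-! ### A law of large numbers for the excess of down-steps -/

section LargeNumbers

variable {Ω : Type*} [MeasurableSpace Ω] {μ : Measure Ω}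

/-- A number `n` exceeds the last square `k ^ 2` by at most `2 * k`, so bounded steps add only `O(k)
= o(k ^ 2)` between squares. -/
lemma tendsto_div_of_sq_subseq {M : ℕ → ℝ} (hM : ∀ n, |M (n + 1) - M n| ≤ 1)
    (h : Tendsto (fun k : ℕ => M ((k + 1) ^ 2) / ((k : ℝ) + 1) ^ 2) atTop (𝓝 0)) :
    Tendsto (fun n : ℕ => M n / n) atTop (𝓝 0) := by
  have hdist : ∀ n j, |M (n + j) - M n| ≤ j := by
    intro n j
    induction j with
    | zero => simp
    | succ j ih =>
      have := abs_sub_le (M (n + (j + 1))) (M (n + j)) (M n)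
      have h1 := hM (n + j)
      push_cast
      rw [← add_assoc] at this ⊢
      linarith
  have h' : Tendsto (fun k : ℕ => M (k ^ 2) / (k : ℝ) ^ 2) atTop (𝓝 0) := by
    rw [← tendsto_add_atTop_iff_nat 1]
    simpa using h
  have hsqrt : Tendsto Nat.sqrt atTop atTop :=
    tendsto_atTop.2 fun k => by
      filter_upwards [eventually_ge_atTop (k * k)] with n hn
      exact Nat.le_sqrt.2 hn
  have hb : Tendsto (fun k : ℕ => |M (k ^ 2) / (k : ℝ) ^ 2| + 2 * (1 / (k : ℝ))) atTop (𝓝 0) := by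
    simpa using h'.abs.add (tendsto_one_div_atTop_nhds_zero_nat.const_mul (2 : ℝ))
  refine squeeze_zero_norm' ?_ (hb.comp hsqrt)
  filter_upwards [eventually_gt_atTop 0] with n hn
  have hk : 0 < Nat.sqrt n := Nat.sqrt_pos.2 hn
  have h1 : Nat.sqrt n ^ 2 ≤ n := Nat.sqrt_le' n
  have h2 : n ≤ Nat.sqrt n ^ 2 + 2 * Nat.sqrt n := by
    have := Nat.sqrt_le_add n
    nlinarith
  simp only [Function.comp]
  generalize Nat.sqrt n = k at hk h1 h2
  obtain ⟨j, rfl⟩ := Nat.exists_eq_add_of_le h1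
  have hj : j ≤ 2 * k := by omega
  have hj' : (j : ℝ) ≤ 2 * k := by exact_mod_cast hj
  have hk' : (0 : ℝ) < k := by exact_mod_cast hk
  have hd := hdist (k ^ 2) j
  have h3 : |M (k ^ 2 + j)| ≤ |M (k ^ 2)| + 2 * k := by
    have := abs_sub_abs_le_abs_sub (M (k ^ 2 + j)) (M (k ^ 2))
    linarith
  rw [Real.norm_eq_abs, abs_div, abs_div, abs_of_pos (show (0 : ℝ) < (k : ℝ) ^ 2 by positivity),
    Nat.abs_cast]
  calc |M (k ^ 2 + j)| / ((k ^ 2 + j : ℕ) : ℝ) ≤ (|M (k ^ 2)| + 2 * k) / ((k ^ 2 + j : ℕ) : ℝ) := by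
        gcongr
    _ ≤ (|M (k ^ 2)| + 2 * k) / (k : ℝ) ^ 2 := by
        apply div_le_div_of_nonneg_left (by positivity) (by positivity)
        push_cast
        linarith [(Nat.cast_nonneg j : (0 : ℝ) ≤ j)]
    _ = _ := by field_simp

/-- A process with bounded steps and linearly growing second moments is almost surely `o(n)`. -/
lemma ae_tendsto_div_of_second_moment {M : ℕ → Ω → ℝ} (hmeas : ∀ n, Measurable (M n))
    (hint : ∀ n, Integrable (fun ω => M n ω ^ 2) μ)
    (hstep : ∀ n ω, |M (n + 1) ω - M n ω| ≤ 1) (hsq : ∀ n : ℕ, ∫ ω, M n ω ^ 2 ∂μ ≤ n) :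
    ∀ᵐ ω ∂μ, Tendsto (fun n : ℕ => M n ω / n) atTop (𝓝 0) := by
  -- Along the squares the normalised second moments are at most `1 / (k + 1) ^ 2`. Hence the sum of
  -- the `f k` has finite expectation and is almost surely finite, so its terms tend to zero.
  let f : ℕ → Ω → ENNReal := fun k ω => ENNReal.ofReal ((M ((k + 1) ^ 2) ω / ((k : ℝ) + 1) ^ 2) ^ 2)
  have hf : ∀ k, Measurable (f k) := fun k =>
    (((hmeas _).div_const _).pow_const 2).ennreal_ofReal
  have hfint : ∀ k, ∫⁻ ω, f k ω ∂μ ≤ ENNReal.ofReal (1 / ((k : ℝ) + 1) ^ 2) := by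
    intro k
    have hi : Integrable (fun ω => (M ((k + 1) ^ 2) ω / ((k : ℝ) + 1) ^ 2) ^ 2) μ := by
      simp only [div_pow]
      exact (hint _).div_const _
    rw [← ofReal_integral_eq_lintegral_ofReal hi (Eventually.of_forall fun ω => sq_nonneg _)]
    apply ENNReal.ofReal_le_ofReal
    simp only [div_pow]
    rw [integral_div, div_le_div_iff₀ (by positivity) (by positivity)]
    have := hsq ((k + 1) ^ 2)
    push_cast at this
    have h0 : (0 : ℝ) < ((k : ℝ) + 1) ^ 2 := by positivity
    nlinarith
  have hsum : ∫⁻ ω, ∑' k, f k ω ∂μ ≠ ⊤ := by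
    rw [lintegral_tsum fun k => (hf k).aemeasurable]
    refine ne_top_of_le_ne_top ?_ (ENNReal.tsum_le_tsum hfint)
    have hs : Summable fun k : ℕ => 1 / ((k : ℝ) + 1) ^ 2 := by
      have := (summable_nat_add_iff 1).2 (Real.summable_one_div_nat_pow.2 one_lt_two)
      simpa using this
    rw [← ENNReal.ofReal_tsum_of_nonneg (fun k => by positivity) hs]
    exact ENNReal.ofReal_ne_top
  filter_upwards [ae_lt_top (Measurable.tsum hf) hsum] with ω hω
  apply tendsto_div_of_sq_subseq fun n => hstep n ω
  have h1 := ENNReal.tendsto_atTop_zero_of_tsum_ne_top hω.ne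
  have h2 := (ENNReal.tendsto_toReal ENNReal.zero_ne_top).comp h1
  have h3 : Tendsto (fun k : ℕ => (M ((k + 1) ^ 2) ω / ((k : ℝ) + 1) ^ 2) ^ 2) atTop (𝓝 0) := by
    simpa [f, Function.comp_def, ENNReal.toReal_ofReal (sq_nonneg _)] using h2
  have h4 := h3.sqrt
  simp only [Real.sqrt_sq_eq_abs, Real.sqrt_zero] at h4
  exact (tendsto_zero_iff_abs_tendsto_zero _).2 h4

/-- The walk is adapted, and non-anticipating: the level before step `n` does not depend on step
`n`. -/
lemma level_congr {m z₀ : ℕ} {β β' : ℕ → Bool} {n : ℕ} (h : ∀ k < n, β k = β' k) :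
    ∀ k ≤ n, level m z₀ β k = level m z₀ β' k := by
  intro k
  induction k with
  | zero => intro _; rfl
  | succ k ih => intro hk; rw [level, level, ih (by omega), h k (by omega)]

lemma excess_congr {m z₀ z : ℕ} {p : ℝ} {β β' : ℕ → Bool} {n : ℕ} (h : ∀ k < n, β k = β' k) :
    excess p (level m z₀ β) β z n = excess p (level m z₀ β') β' z n := by
  refine Finset.sum_congr rfl fun k hk => ?_
  have hk' := Finset.mem_range.1 hk
  rw [level_congr h k hk'.le, h k hk']

/-- The sequence starting with the given word and going on with `false`. -/
def extendWord {n : ℕ} (v : Finset.range n → Bool) (k : ℕ) : Bool :=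
  if h : k ∈ Finset.range n then v ⟨k, h⟩ else false

lemma extendWord_restrict (β : ℕ → Bool) {n k : ℕ} (h : k < n) :
    extendWord (fun i : Finset.range n => β i) k = β k := by
  simp [extendWord, h]

variable [IsProbabilityMeasure μ] {β : ℕ → Ω → Bool} {p : ℝ}

/-- For independent steps with probability `p` of going down, the number of down-steps from a
level differs from `p` times the number of visits by `o(n)`. -/
lemma ae_tendsto_excess_div (hβ : ∀ n, Measurable (β n)) (hind : iIndepFun β μ)
    (hp : ∀ n, μ.real (β n ⁻¹' {true}) = p) (m z₀ z : ℕ) :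
    ∀ᵐ ω ∂μ, Tendsto (fun n : ℕ => excess p (level m z₀ fun k => β k ω) (fun k => β k ω) z n / n)
      atTop (𝓝 0) := by
  have hp0 : 0 ≤ p := hp 0 ▸ measureReal_nonneg
  have hp1 : p ≤ 1 := hp 0 ▸ measureReal_le_one
  let M : ℕ → Ω → ℝ := fun n ω => excess p (level m z₀ fun k => β k ω) (fun k => β k ω) z n
  let d : ℕ → Ω → ℝ := fun n ω => (if β n ω then 1 else 0) - p
  let g : ℕ → Ω → ℝ := fun n ω => if level m z₀ (fun k => β k ω) n = z then 1 else 0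
  -- Factoring through the finite word of the first `n` steps makes measurability automatic and lets
  -- independence of finite blocks apply.
  have hM : ∀ n, M n = (fun v : Finset.range n → Bool =>
      excess p (level m z₀ (extendWord v)) (extendWord v) z n) ∘ fun ω i => β i ω := by
    intro n; funext ω
    exact (excess_congr fun k hk => extendWord_restrict (fun k => β k ω) hk).symm
  have hg : ∀ n, g n = (fun v : Finset.range n → Bool =>
      if level m z₀ (extendWord v) n = z then (1 : ℝ) else 0) ∘ fun ω i => β i ω := by
    intro n; funext ω
    simp only [g, Function.comp]
    rw [level_congr (fun k hk => extendWord_restrict (fun k => β k ω) hk) n le_rfl]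
  have hw : ∀ n, Measurable fun ω (i : Finset.range n) => β i ω :=
    fun n => measurable_pi_lambda _ fun i => hβ i
  have hMm : ∀ n, Measurable (M n) := fun n => by
    rw [hM]; exact (measurable_of_countable _).comp (hw n)
  have hgm : ∀ n, Measurable (g n) := fun n => by
    rw [hg]; exact (measurable_of_countable _).comp (hw n)
  have hd' : ∀ n, d n = (fun b : Bool => (if b then 1 else 0) - p) ∘ β n := fun n => rfl
  have hdm : ∀ n, Measurable (d n) := fun n => by
    rw [hd']; exact (measurable_of_countable _).comp (hβ n)
  have hsucc : ∀ n ω, M (n + 1) ω = M n ω + g n ω * d n ω := by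
    intro n ω
    simp only [M, g, d, excess, Finset.sum_range_succ]
    split_ifs <;> simp
  have hd1 : ∀ n ω, |d n ω| ≤ 1 := by
    intro n ω
    simp only [d]
    rw [abs_le]
    split_ifs <;> constructor <;> linarith
  have hg1 : ∀ n ω, |g n ω| ≤ 1 := by
    intro n ω
    simp only [g]
    split_ifs <;> simp
  have hgd1 : ∀ n ω, |g n ω * d n ω| ≤ 1 := fun n ω => by
    rw [abs_mul]; exact mul_le_one₀ (hg1 n ω) (abs_nonneg _) (hd1 n ω)
  have hM1 : ∀ n ω, |M n ω| ≤ n := by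
    intro n ω
    induction n with
    | zero => simp [M, excess]
    | succ n ih =>
      rw [hsucc]
      push_cast
      exact (abs_add_le _ _).trans (add_le_add ih (hgd1 n ω))
  have hMg : ∀ n, Integrable (fun ω => M n ω * g n ω) μ := fun n =>
    Integrable.of_bound ((hMm n).mul (hgm n)).aestronglyMeasurable n
      (Eventually.of_forall fun ω => by
        rw [Real.norm_eq_abs, abs_mul]
        exact (mul_le_mul (hM1 n ω) (hg1 n ω) (abs_nonneg _) (Nat.cast_nonneg _)).trans
          (mul_one _).le)
  have hdi : ∀ n, Integrable (d n) μ := fun n =>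
    Integrable.of_bound (hdm n).aestronglyMeasurable 1 (Eventually.of_forall (hd1 n))
  have hM2 : ∀ n, Integrable (fun ω => M n ω ^ 2) μ := fun n =>
    Integrable.of_bound ((hMm n).pow_const 2).aestronglyMeasurable ((n : ℝ) ^ 2)
      (Eventually.of_forall fun ω => by
        rw [Real.norm_eq_abs, abs_pow]
        exact pow_le_pow_left₀ (abs_nonneg _) (hM1 n ω) 2)
  have hgd2 : ∀ n, Integrable (fun ω => (g n ω * d n ω) ^ 2) μ := fun n =>
    Integrable.of_bound (((hgm n).mul (hdm n)).pow_const 2).aestronglyMeasurable 1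
      (Eventually.of_forall fun ω => by
        rw [Real.norm_eq_abs, abs_pow]
        exact pow_le_one₀ (abs_nonneg _) (hgd1 n ω))
  have hMgd : ∀ n, Integrable (fun ω => M n ω * g n ω * d n ω) μ := fun n =>
    Integrable.of_bound (((hMm n).mul (hgm n)).mul (hdm n)).aestronglyMeasurable n
      (Eventually.of_forall fun ω => by
        rw [Real.norm_eq_abs, mul_assoc, abs_mul]
        exact (mul_le_mul (hM1 n ω) (hgd1 n ω) (abs_nonneg _) (Nat.cast_nonneg _)).trans
          (mul_one _).le)
  have hd0 : ∀ n, ∫ ω, d n ω ∂μ = 0 := by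
    intro n
    have h1 : (fun ω => if β n ω then (1 : ℝ) else 0) = (β n ⁻¹' {true}).indicator 1 := by
      funext ω
      by_cases h : β n ω = true <;> simp [h, Set.indicator]
    have hmt : MeasurableSet (β n ⁻¹' {true}) := hβ n (measurableSet_singleton _)
    simp only [d]
    rw [integral_sub _ (integrable_const p), h1, integral_indicator_one hmt, hp n]
    · simp
    · rw [h1]; exact (integrable_const 1).indicator hmt
  -- Orthogonality of martingale increments: `M n * g n` depends on the steps before `n` only, and
  -- `d n` is centred and depends on step `n` alone.
  have horth : ∀ n, ∫ ω, M n ω * g n ω * d n ω ∂μ = 0 := by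
    intro n
    have hi : IndepFun (fun ω => M n ω * g n ω) (d n) μ := by
      have h := hind.indepFun_finset (Finset.range n) {n} (by simp) hβ
      have h1 : (fun ω => M n ω * g n ω) = (fun v : Finset.range n → Bool =>
          excess p (level m z₀ (extendWord v)) (extendWord v) z n *
            if level m z₀ (extendWord v) n = z then (1 : ℝ) else 0) ∘ fun ω i => β i ω := by
        funext ω
        rw [hM, hg]; rfl
      have h2 : d n = (fun v : ({n} : Finset ℕ) → Bool =>
          (if v ⟨n, Finset.mem_singleton_self n⟩ then 1 else 0) - p) ∘ fun ω i => β i ω := rfl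
      rw [h1, h2]
      exact h.comp (measurable_of_countable _) (measurable_of_countable _)
    have := hi.integral_mul_eq_mul_integral (hMg n).aestronglyMeasurable (hdi n).aestronglyMeasurable
    rw [hd0, mul_zero] at this
    exact this
  refine ae_tendsto_div_of_second_moment (M := M) hMm hM2 (fun n ω => ?_) (fun n => ?_)
  · rw [hsucc, add_sub_cancel_left]; exact hgd1 n ω
  · induction n with
    | zero => simp [M, excess]
    | succ n ih =>
      -- The cross term has mean zero and the squared increment is at most `1`, so the second moment
      -- grows by at most `1` per step.
      have h1 : ∀ ω, M (n + 1) ω ^ 2 =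
          M n ω ^ 2 + 2 * (M n ω * g n ω * d n ω) + (g n ω * d n ω) ^ 2 := by
        intro ω; rw [hsucc]; ring
      simp only [h1]
      have hsum : Integrable (fun ω => M n ω ^ 2 + 2 * (M n ω * g n ω * d n ω)) μ :=
        (hM2 n).add ((hMgd n).const_mul 2)
      rw [integral_add hsum (hgd2 n),
        integral_add (hM2 n) ((hMgd n).const_mul 2), integral_const_mul, horth]
      have h2 : ∫ ω, (g n ω * d n ω) ^ 2 ∂μ ≤ 1 := by
        have := integral_mono (hgd2 n) (integrable_const (1 : ℝ)) (μ := μ) fun ω => by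
          have := pow_le_one₀ (n := 2) (abs_nonneg _) (hgd1 n ω)
          rwa [sq_abs] at this
        simpa using this
      push_cast
      linarith

end LargeNumbers

/-! ### The lack of memory of the exponential distribution -/

section Exponential

lemma lintegral_expMeasure (r : ℝ) {f : ℝ → ENNReal} (hf : Measurable f) :
    ∫⁻ x, f x ∂expMeasure r = ∫⁻ x, exponentialPDF r x * f x :=
  lintegral_withDensity_eq_lintegral_mul _ (measurable_exponentialPDFReal r).ennreal_ofReal hf

lemma measurable_exponentialPDF (r : ℝ) : Measurable (exponentialPDF r) :=
  (measurable_exponentialPDFReal r).ennreal_ofReal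

lemma ae_pos_expMeasure (r : ℝ) : ∀ᵐ x ∂expMeasure r, 0 < x := by
  rw [ae_iff, show {x : ℝ | ¬ 0 < x} = Set.Iic 0 by ext; simp]
  rw [← lintegral_indicator_one measurableSet_Iic,
    lintegral_expMeasure r (measurable_one.indicator measurableSet_Iic)]
  refine (lintegral_eq_zero_iff ((measurable_exponentialPDF r).mul
    (measurable_one.indicator measurableSet_Iic))).2 ?_
  filter_upwards [Measure.ae_ne volume (0 : ℝ)] with x hx
  rcases lt_or_gt_of_ne hx with h | h
  · simp [exponentialPDF_of_neg h]
  · simp [Set.indicator, h.not_ge]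

/-- Lack of memory: after the translation `y = z + x`, the density at `z + x` is `exp (-(r * x))`
times the density at `z`. -/
lemma lintegral_expMeasure_residual (r : ℝ) {G : ℝ → ENNReal} (hG : Measurable G) {x : ℝ}
    (hx : 0 ≤ x) :
    ∫⁻ y, (if x ≤ y then G (y - x) else 0) ∂expMeasure r =
      ENNReal.ofReal (Real.exp (-(r * x))) * ∫⁻ z, G z ∂expMeasure r := by
  have hm : Measurable fun y => if x ≤ y then G (y - x) else 0 :=
    Measurable.ite measurableSet_Ici (hG.comp (measurable_id.sub_const x)) measurable_const
  have hm' : Measurable fun z => exponentialPDF r z * G z := (measurable_exponentialPDF r).mul hG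
  rw [lintegral_expMeasure r hm, lintegral_expMeasure r hG, ← lintegral_const_mul _ hm',
    ← lintegral_add_right_eq_self _ x]
  refine lintegral_congr fun z => ?_
  by_cases hz : 0 ≤ z
  · rw [if_pos (by linarith), add_sub_cancel_right, exponentialPDF_of_nonneg hz,
      exponentialPDF_of_nonneg (by linarith), ← mul_assoc]
    congr 1
    rw [← ENNReal.ofReal_mul (Real.exp_nonneg _), mul_left_comm, ← Real.exp_add]
    congr 3
    ring
  · rw [if_neg (by linarith), exponentialPDF_of_neg (not_le.1 hz)]
    simp

/-- Tilting the density of rate `lam` by `exp (-(r * x))` gives a multiple of the density of rate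
`lam + r`. -/
lemma lintegral_exp_neg_expMeasure {lam r : ℝ} (hlam : 0 < lam) (hr : 0 < r) :
    ∫⁻ x, ENNReal.ofReal (Real.exp (-(r * x))) ∂expMeasure lam =
      ENNReal.ofReal (lam / (lam + r)) := by
  rw [lintegral_expMeasure lam (by fun_prop)]
  have h : ∀ x, exponentialPDF lam x * ENNReal.ofReal (Real.exp (-(r * x))) =
      ENNReal.ofReal (lam / (lam + r)) * exponentialPDF (lam + r) x := by
    intro x
    by_cases hx : 0 ≤ x
    · rw [exponentialPDF_of_nonneg hx, exponentialPDF_of_nonneg hx,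
        ← ENNReal.ofReal_mul (by positivity), ← ENNReal.ofReal_mul (by positivity), mul_assoc,
        ← Real.exp_add, ← mul_assoc, div_mul_cancel₀ _ (by positivity)]
      congr 3
      ring
    · rw [exponentialPDF_of_neg (not_le.1 hx), exponentialPDF_of_neg (not_le.1 hx)]
      simp
  rw [lintegral_congr h, lintegral_const_mul _ (measurable_exponentialPDF _),
    lintegral_exponentialPDF_eq_one (by positivity), mul_one]

/-- If `x` and `y` are independent exponential times, then `x ≤ y` has probability
`lam / (lam + r)` and, given this, `y - x` is distributed like `y`. -/
lemma lintegral_lintegral_residual {lam r : ℝ} (hlam : 0 < lam) (hr : 0 < r) {G : ℝ → ENNReal}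
    (hG : Measurable G) :
    ∫⁻ x, ∫⁻ y, (if x ≤ y then G (y - x) else 0) ∂expMeasure r ∂expMeasure lam =
      ENNReal.ofReal (lam / (lam + r)) * ∫⁻ z, G z ∂expMeasure r := by
  have h : ∀ᵐ x ∂expMeasure lam, ∫⁻ y, (if x ≤ y then G (y - x) else 0) ∂expMeasure r =
      ENNReal.ofReal (Real.exp (-(r * x))) * ∫⁻ z, G z ∂expMeasure r := by
    filter_upwards [ae_pos_expMeasure lam] with x hx
    exact lintegral_expMeasure_residual r hG hx.le
  rw [lintegral_congr_ae h, lintegral_mul_const _ (by fun_prop),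
    lintegral_exp_neg_expMeasure hlam hr]

lemma integral_id_expMeasure {r : ℝ} (hr : 0 < r) : ∫ x, x ∂expMeasure r = 1 / r := by
  have h1 : ∫ x, x ∂expMeasure r = ∫ x, exponentialPDFReal r x * x := by
    rw [show expMeasure r = volume.withDensity (exponentialPDF r) from rfl,
      integral_withDensity_eq_integral_toReal_smul (measurable_exponentialPDF r)
        (Eventually.of_forall fun x => ENNReal.ofReal_lt_top)]
    refine integral_congr_ae (Eventually.of_forall fun x => ?_)
    simp only [exponentialPDF, ENNReal.toReal_ofReal (exponentialPDFReal_nonneg hr x), smul_eq_mul]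
  have h2 : (fun x => exponentialPDFReal r x * x) =ᵐ[volume] (Set.Ioi (0 : ℝ)).indicator
      fun x => r * (x ^ ((2 : ℝ) - 1) * Real.exp (-(r * x))) := by
    filter_upwards with x
    by_cases hx : 0 < x
    · rw [Set.indicator_of_mem (Set.mem_Ioi.2 hx)]
      simp only [exponentialPDFReal, gammaPDFReal, if_pos hx.le]
      norm_num
      ring
    · rw [Set.indicator_of_notMem (by simpa using hx)]
      rcases (not_lt.1 hx).lt_or_eq with h | h
      · simp [exponentialPDFReal, gammaPDFReal, h.not_ge]
      · simp [h]
  rw [h1, integral_congr_ae h2, integral_indicator measurableSet_Ioi, integral_const_mul,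
    Real.integral_rpow_mul_exp_neg_mul_Ioi (by norm_num) hr, Real.Gamma_two, mul_one,
    show (1 / r) ^ (2 : ℝ) = (1 / r) ^ 2 from Real.rpow_natCast _ 2]
  field_simp

lemma integrable_id_expMeasure {r : ℝ} (hr : 0 < r) : Integrable (fun x => x) (expMeasure r) := by
  by_contra h
  -- The integral of a non-integrable function is `0` by convention, whereas this one is `1 / r ≠
  -- 0`.
  have := integral_id_expMeasure hr
  rw [integral_undef h] at this
  exact (one_div_pos.2 hr).ne this

end Exponential

/-! ### The sequences of residual waiting times -/

section Residual

/-- Prepend a term to a sequence. -/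
def consSeq (a : ℝ) (f : ℕ → ℝ) : ℕ → ℝ
  | 0 => a
  | n + 1 => f n

/-- Drop the first term of a sequence. -/
def tailSeq (f : ℕ → ℝ) (n : ℕ) : ℝ := f (n + 1)

lemma measurable_consSeq : Measurable fun p : ℝ × (ℕ → ℝ) => consSeq p.1 p.2 := by
  refine measurable_pi_lambda _ fun n => ?_
  cases n with
  | zero => exact measurable_fst
  | succ n => exact (measurable_pi_apply n).comp measurable_snd

lemma measurable_tailSeq : Measurable tailSeq :=
  measurable_pi_lambda _ fun n => measurable_pi_apply (n + 1)

/-- After the earlier one of two first arrivals, the waiting times that remain. -/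
noncomputable def residual (q : (ℕ → ℝ) × (ℕ → ℝ)) : (ℕ → ℝ) × (ℕ → ℝ) :=
  if q.1 0 ≤ q.2 0 then (tailSeq q.1, consSeq (q.2 0 - q.1 0) (tailSeq q.2))
  else (consSeq (q.1 0 - q.2 0) (tailSeq q.1), tailSeq q.2)

/-- Whether the first arrival of the first sequence comes first. -/
noncomputable def firstKind (q : (ℕ → ℝ) × (ℕ → ℝ)) : Bool := decide (q.1 0 ≤ q.2 0)

lemma measurableSet_first_le : MeasurableSet {q : (ℕ → ℝ) × (ℕ → ℝ) | q.1 0 ≤ q.2 0} :=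
  measurableSet_le ((measurable_pi_apply 0).comp measurable_fst)
    ((measurable_pi_apply 0).comp measurable_snd)

lemma measurable_residual_left : Measurable fun q : (ℕ → ℝ) × (ℕ → ℝ) =>
    (tailSeq q.1, consSeq (q.2 0 - q.1 0) (tailSeq q.2)) :=
  (measurable_tailSeq.comp measurable_fst).prodMk (measurable_consSeq.comp
    ((((measurable_pi_apply 0).comp measurable_snd).sub
      ((measurable_pi_apply 0).comp measurable_fst)).prodMk (measurable_tailSeq.comp measurable_snd)))

lemma measurable_residual : Measurable residual := by
  refine Measurable.ite measurableSet_first_le measurable_residual_left ?_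
  exact measurable_swap.comp (measurable_residual_left.comp measurable_swap)

lemma measurable_firstKind : Measurable firstKind := by
  refine measurable_to_bool ?_
  convert! measurableSet_first_le using 1
  ext q
  simp [firstKind]

/-- The law of the gaps of two independent Poisson processes. -/
noncomputable def gapLaw (lam r : ℝ) : Measure ((ℕ → ℝ) × (ℕ → ℝ)) :=
  (Measure.infinitePi fun _ : ℕ => expMeasure lam).prod (Measure.infinitePi fun _ => expMeasure r)

/-- A product measure is determined by its values on boxes with finitely many constraints, and such
a box splits into its coordinate `0` and the shifted rest. This allows the first waiting time to be
integrated separately. -/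
lemma map_consSeq (μ : Measure ℝ) [IsProbabilityMeasure μ] :
    (μ.prod (Measure.infinitePi fun _ : ℕ => μ)).map (fun p => consSeq p.1 p.2) =
      Measure.infinitePi fun _ : ℕ => μ := by
  apply Measure.eq_infinitePi
  intro s t ht
  have hs : MeasurableSet (Set.pi (s : Set ℕ) t) :=
    MeasurableSet.pi s.countable_toSet fun i _ => ht i
  rw [Measure.map_apply measurable_consSeq hs]
  let s' : Finset ℕ := s.preimage Nat.succ Nat.succ_injective.injOn
  have hset : (fun p : ℝ × (ℕ → ℝ) => consSeq p.1 p.2) ⁻¹' (Set.pi (s : Set ℕ) t) =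
      (if 0 ∈ s then t 0 else Set.univ) ×ˢ Set.pi (s' : Set ℕ) (fun i => t (i + 1)) := by
    ext ⟨a, f⟩
    simp only [Set.mem_preimage, Set.mem_pi, Set.mem_prod, Finset.mem_coe, s', Finset.mem_preimage]
    constructor
    · intro h
      refine ⟨?_, fun i hi => h (i + 1) hi⟩
      split_ifs with h0
      · exact h 0 h0
      · trivial
    · rintro ⟨h1, h2⟩ i hi
      cases i with
      | zero => rw [if_pos hi] at h1; exact h1
      | succ i => exact h2 i hi
  have himg : s.erase 0 = s'.map ⟨Nat.succ, Nat.succ_injective⟩ := by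
    ext i
    simp only [Finset.mem_erase, Finset.mem_map, Function.Embedding.coeFn_mk, s',
      Finset.mem_preimage]
    constructor
    · rintro ⟨h1, h2⟩
      obtain ⟨j, rfl⟩ := Nat.exists_eq_succ_of_ne_zero h1
      exact ⟨j, h2, rfl⟩
    · rintro ⟨j, hj, rfl⟩
      exact ⟨Nat.succ_ne_zero j, hj⟩
  rw [hset, Measure.prod_prod, Measure.infinitePi_pi _ fun i _ => ht (i + 1)]
  have hprod : ∏ i ∈ s', μ (t (i + 1)) = ∏ i ∈ s.erase 0, μ (t i) := by
    rw [himg, Finset.prod_map]; rfl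
  rw [hprod]
  split_ifs with h0
  · exact Finset.mul_prod_erase s (fun i => μ (t i)) h0
  · rw [measure_univ, one_mul, Finset.erase_eq_of_notMem h0]

variable {lam r : ℝ}

lemma isProbabilityMeasure_gapLaw (hlam : 0 < lam) (hr : 0 < r) :
    IsProbabilityMeasure (gapLaw lam r) := by
  have := isProbabilityMeasure_expMeasure hlam
  have := isProbabilityMeasure_expMeasure hr
  unfold gapLaw
  infer_instance

lemma lintegral_infinitePi_cons {μ : Measure ℝ} [IsProbabilityMeasure μ] {F : (ℕ → ℝ) → ENNReal}
    (hF : Measurable F) :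
    ∫⁻ x, F x ∂(Measure.infinitePi fun _ : ℕ => μ) =
      ∫⁻ a, ∫⁻ f, F (consSeq a f) ∂(Measure.infinitePi fun _ : ℕ => μ) ∂μ := by
  conv_lhs => rw [← map_consSeq μ]
  rw [lintegral_map hF measurable_consSeq]
  exact lintegral_prod _ (hF.comp measurable_consSeq).aemeasurable

/-- The event that the first sequence comes first is independent of the residual waiting times,
and these have the original law. -/
lemma gapLaw_first_le (hlam : 0 < lam) (hr : 0 < r) {A : Set ((ℕ → ℝ) × (ℕ → ℝ))}
    (hA : MeasurableSet A) :
    gapLaw lam r {q | q.1 0 ≤ q.2 0 ∧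
        (tailSeq q.1, consSeq (q.2 0 - q.1 0) (tailSeq q.2)) ∈ A} =
      ENNReal.ofReal (lam / (lam + r)) * gapLaw lam r A := by
  have := isProbabilityMeasure_expMeasure hlam
  have := isProbabilityMeasure_expMeasure hr
  set μ := Measure.infinitePi fun _ : ℕ => expMeasure lam with hμ
  set ν := Measure.infinitePi fun _ : ℕ => expMeasure r with hν
  set F : (ℕ → ℝ) → (ℕ → ℝ) → ENNReal := fun x y => A.indicator 1 (x, y) with hF
  have hFm : Measurable (Function.uncurry F) := measurable_one.indicator hA
  have hF3 : Measurable fun z : (ℝ × (ℕ → ℝ)) × (ℕ → ℝ) => F z.1.2 (consSeq z.1.1 z.2) :=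
    hFm.comp ((measurable_snd.comp measurable_fst).prodMk
      (measurable_consSeq.comp ((measurable_fst.comp measurable_fst).prodMk measurable_snd)))
  -- All waiting times but the residual `z` are integrated out, which reduces the claim to the
  -- two-variable identity `lintegral_lintegral_residual`.
  set G : ℝ → ENNReal := fun z => ∫⁻ x, ∫⁻ y, F x (consSeq z y) ∂ν ∂μ with hG
  have hG2 : Measurable fun z : ℝ × (ℕ → ℝ) => ∫⁻ y, F z.2 (consSeq z.1 y) ∂ν :=
    hF3.lintegral_prod_right'
  have hGm : Measurable G := hG2.lintegral_prod_right'
  have hrhs : gapLaw lam r A = ∫⁻ z, G z ∂expMeasure r := by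
    rw [← lintegral_indicator_one hA, gapLaw, lintegral_prod _ (measurable_one.indicator hA).aemeasurable]
    have h : ∀ x, ∫⁻ y, F x y ∂ν = ∫⁻ z, ∫⁻ y, F x (consSeq z y) ∂ν ∂expMeasure r := fun x =>
      lintegral_infinitePi_cons (hFm.comp measurable_prodMk_left)
    refine (lintegral_congr h).trans ?_
    exact lintegral_lintegral_swap (f := fun x z => ∫⁻ y, F x (consSeq z y) ∂ν)
      (hG2.comp measurable_swap).aemeasurable
  have hS : MeasurableSet {q : (ℕ → ℝ) × (ℕ → ℝ) | q.1 0 ≤ q.2 0 ∧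
      (tailSeq q.1, consSeq (q.2 0 - q.1 0) (tailSeq q.2)) ∈ A} :=
    measurableSet_first_le.inter (measurable_residual_left hA)
  set H : (ℕ → ℝ) → (ℕ → ℝ) → ENNReal := fun x y => if x 0 ≤ y 0 then
    F (tailSeq x) (consSeq (y 0 - x 0) (tailSeq y)) else 0 with hH
  have hHm : Measurable (Function.uncurry H) :=
    Measurable.ite measurableSet_first_le (hFm.comp measurable_residual_left) measurable_const
  have hlhs : gapLaw lam r {q | q.1 0 ≤ q.2 0 ∧
      (tailSeq q.1, consSeq (q.2 0 - q.1 0) (tailSeq q.2)) ∈ A} = ∫⁻ x, ∫⁻ y, H x y ∂ν ∂μ := by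
    rw [← lintegral_indicator_one hS, gapLaw,
      lintegral_prod _ (measurable_one.indicator hS).aemeasurable]
    refine lintegral_congr fun x => lintegral_congr fun y => ?_
    simp only [hH, hF, Set.indicator, Set.mem_ofPred_eq]
    split_ifs <;> simp_all
  rw [hlhs, hrhs, ← lintegral_lintegral_residual hlam hr hGm]
  rw [lintegral_infinitePi_cons (F := fun x => ∫⁻ y, H x y ∂ν) hHm.lintegral_prod_right']
  refine lintegral_congr fun a => ?_
  have h1 : ∀ x, ∫⁻ y, H (consSeq a x) y ∂ν =
      ∫⁻ b, (if a ≤ b then ∫⁻ y, F x (consSeq (b - a) y) ∂ν else 0) ∂expMeasure r := by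
    intro x
    rw [lintegral_infinitePi_cons (F := H (consSeq a x)) hHm.of_uncurry_left]
    refine lintegral_congr fun b => ?_
    by_cases hab : a ≤ b
    · rw [if_pos hab]
      exact lintegral_congr fun y => if_pos (show consSeq a x 0 ≤ consSeq b y 0 from hab)
    · rw [if_neg hab]
      exact (lintegral_congr fun y => if_neg (show ¬ consSeq a x 0 ≤ consSeq b y 0 from hab)).trans
        lintegral_zero
  rw [lintegral_congr h1, lintegral_lintegral_swap]
  · refine lintegral_congr fun b => ?_
    split_ifs
    · rfl
    · simp
  · refine Measurable.aemeasurable (Measurable.ite ?_ ?_ measurable_const)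
    · exact measurable_snd measurableSet_Ici
    · exact hG2.comp ((measurable_snd.sub_const a).prodMk measurable_fst)

lemma gapLaw_map_swap (hlam : 0 < lam) (hr : 0 < r) :
    (gapLaw lam r).map Prod.swap = gapLaw r lam := by
  have := isProbabilityMeasure_expMeasure hlam
  have := isProbabilityMeasure_expMeasure hr
  exact Measure.prod_swap

lemma ae_pos_gapLaw (hlam : 0 < lam) (hr : 0 < r) : ∀ᵐ q ∂gapLaw lam r, 0 < q.2 0 := by
  have := isProbabilityMeasure_expMeasure hlam
  have := isProbabilityMeasure_expMeasure hr
  have h : MeasurePreserving (fun q : (ℕ → ℝ) × (ℕ → ℝ) => q.2 0) (gapLaw lam r) (expMeasure r) :=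
    (measurePreserving_eval_infinitePi (fun _ : ℕ => expMeasure r) 0).comp measurePreserving_snd
  exact h.quasiMeasurePreserving.ae (ae_pos_expMeasure r)

/-- Intersecting `A` with a positive first waiting time costs nothing, and for the residual sequence
this positivity excludes a tie. The strict form is needed for energy arrivals, since `firstKind`
assigns ties to the first sequence. -/
lemma gapLaw_first_lt (hlam : 0 < lam) (hr : 0 < r) {A : Set ((ℕ → ℝ) × (ℕ → ℝ))}
    (hA : MeasurableSet A) :
    gapLaw lam r {q | q.1 0 < q.2 0 ∧
        (tailSeq q.1, consSeq (q.2 0 - q.1 0) (tailSeq q.2)) ∈ A} =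
      ENNReal.ofReal (lam / (lam + r)) * gapLaw lam r A := by
  have hpos : MeasurableSet {q : (ℕ → ℝ) × (ℕ → ℝ) | 0 < q.2 0} :=
    ((measurable_pi_apply 0).comp measurable_snd) measurableSet_Ioi
  have h := gapLaw_first_le hlam hr (hA.inter hpos)
  have h2 : gapLaw lam r (A ∩ {q | 0 < q.2 0}) = gapLaw lam r A := by
    apply measure_congr
    filter_upwards [ae_pos_gapLaw hlam hr] with q hq
    exact propext ⟨fun h => h.1, fun h => ⟨h, hq⟩⟩
  rw [h2] at h
  rw [← h]
  congr 1
  ext q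
  simp only [Set.mem_ofPred_eq, Set.mem_inter_iff, consSeq, sub_pos]
  constructor
  · rintro ⟨h1, h2⟩; exact ⟨h1.le, h2, h1⟩
  · rintro ⟨h1, h2, h3⟩; exact ⟨h3, h2⟩

lemma gapLaw_firstKind_true (hlam : 0 < lam) (hr : 0 < r) {A : Set ((ℕ → ℝ) × (ℕ → ℝ))}
    (hA : MeasurableSet A) :
    gapLaw lam r (firstKind ⁻¹' {true} ∩ residual ⁻¹' A) =
      ENNReal.ofReal (lam / (lam + r)) * gapLaw lam r A := by
  rw [← gapLaw_first_le hlam hr hA]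
  congr 1
  ext q
  simp only [Set.mem_inter_iff, Set.mem_preimage, Set.mem_singleton_iff, firstKind,
    decide_eq_true_eq, Set.mem_ofPred_eq]
  refine and_congr_right fun h => ?_
  rw [residual, if_pos h]

lemma gapLaw_firstKind_false (hlam : 0 < lam) (hr : 0 < r) {A : Set ((ℕ → ℝ) × (ℕ → ℝ))}
    (hA : MeasurableSet A) :
    gapLaw lam r (firstKind ⁻¹' {false} ∩ residual ⁻¹' A) =
      ENNReal.ofReal (r / (r + lam)) * gapLaw lam r A := by
  have hB : MeasurableSet (Prod.swap ⁻¹' A : Set ((ℕ → ℝ) × (ℕ → ℝ))) := measurable_swap hA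
  have h := gapLaw_first_lt hr hlam hB
  rw [← gapLaw_map_swap hlam hr, Measure.map_apply measurable_swap hB] at h
  rw [Measure.map_apply measurable_swap] at h
  · rw [← Set.preimage_comp, Prod.swap_swap_eq, Set.preimage_id] at h
    rw [← h]
    congr 1
    ext q
    simp only [Set.mem_inter_iff, Set.mem_preimage, Set.mem_singleton_iff, firstKind,
      decide_eq_false_iff_not, Set.mem_ofPred_eq, not_le, Prod.fst_swap, Prod.snd_swap]
    refine and_congr_right fun h => ?_
    rw [residual, if_neg (not_le.2 h)]
    rfl
  · refine MeasurableSet.inter ?_ (measurable_residual_left hB)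
    exact measurableSet_lt ((measurable_pi_apply 0).comp measurable_fst)
      ((measurable_pi_apply 0).comp measurable_snd)

/-- The renewal step: for each of the two kinds the residual law is the original one times a
constant, and taking `A = univ` identifies the constant as the probability of that kind. -/
lemma gapLaw_firstKind_inter (hlam : 0 < lam) (hr : 0 < r) (W : Set Bool)
    {A : Set ((ℕ → ℝ) × (ℕ → ℝ))} (hA : MeasurableSet A) :
    gapLaw lam r (firstKind ⁻¹' W ∩ residual ⁻¹' A) =
      gapLaw lam r (firstKind ⁻¹' W) * gapLaw lam r A := by
  have := isProbabilityMeasure_gapLaw hlam hr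
  have hA' := measurable_residual hA
  have h : ((gapLaw lam r).restrict (residual ⁻¹' A)).map firstKind =
      gapLaw lam r A • (gapLaw lam r).map firstKind := by
    apply Measure.ext_of_singleton
    intro b
    have hb : MeasurableSet (firstKind ⁻¹' {b}) := measurable_firstKind (measurableSet_singleton b)
    rw [Measure.smul_apply, Measure.map_apply measurable_firstKind (measurableSet_singleton b),
      Measure.map_apply measurable_firstKind (measurableSet_singleton b),
      Measure.restrict_apply hb, smul_eq_mul, mul_comm]
    cases b
    · have h1 := gapLaw_firstKind_false hlam hr MeasurableSet.univ
      rw [Set.preimage_univ, Set.inter_univ, measure_univ, mul_one] at h1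
      rw [gapLaw_firstKind_false hlam hr hA, h1]
    · have h1 := gapLaw_firstKind_true hlam hr MeasurableSet.univ
      rw [Set.preimage_univ, Set.inter_univ, measure_univ, mul_one] at h1
      rw [gapLaw_firstKind_true hlam hr hA, h1]
  have hW : MeasurableSet W := W.toFinite.measurableSet
  have h2 := congrArg (fun m => m W) h
  simp only [Measure.smul_apply] at h2
  rw [Measure.map_apply measurable_firstKind hW, Measure.map_apply measurable_firstKind hW,
    Measure.restrict_apply (measurable_firstKind hW), smul_eq_mul, mul_comm] at h2
  exact h2

lemma gapLaw_iterate (hlam : 0 < lam) (hr : 0 < r) (W : ℕ → Set Bool) (n : ℕ)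
    {A : Set ((ℕ → ℝ) × (ℕ → ℝ))} (hA : MeasurableSet A) :
    gapLaw lam r ((⋂ k ∈ Finset.range n, (fun q => firstKind (residual^[k] q)) ⁻¹' W k) ∩
        residual^[n] ⁻¹' A) =
      (∏ k ∈ Finset.range n, gapLaw lam r (firstKind ⁻¹' W k)) * gapLaw lam r A := by
  induction n generalizing A with
  | zero => simp
  | succ n ih =>
    have hm : MeasurableSet (firstKind ⁻¹' W n ∩ residual ⁻¹' A) :=
      (measurable_firstKind (W n).toFinite.measurableSet).inter (measurable_residual hA)
    -- The event at index `n` is absorbed into the set reached after `n` iterations, so the renewal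
    -- step applies once more.
    have := ih hm
    rw [Finset.prod_range_succ, mul_assoc, ← gapLaw_firstKind_inter hlam hr (W n) hA, ← this]
    congr 1
    ext q
    simp only [Set.mem_inter_iff, Set.mem_iInter, Finset.mem_range, Set.mem_preimage,
      Function.iterate_succ_apply']
    constructor
    · rintro ⟨h1, h2⟩
      exact ⟨fun k hk => h1 k (by omega), h1 n (by omega), h2⟩
    · rintro ⟨h1, h2, h3⟩
      refine ⟨fun k hk => ?_, h3⟩
      rcases Nat.lt_succ_iff_lt_or_eq.1 hk with h | rfl
      · exact h1 k h
      · exact h2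

lemma gapLaw_preimage_firstKind_iterate (hlam : 0 < lam) (hr : 0 < r) (n : ℕ) (W : Set Bool) :
    gapLaw lam r ((fun q => firstKind (residual^[n] q)) ⁻¹' W) =
      gapLaw lam r (firstKind ⁻¹' W) := by
  have := isProbabilityMeasure_gapLaw hlam hr
  have h := gapLaw_iterate hlam hr (fun _ => Set.univ) n
    (measurable_firstKind W.toFinite.measurableSet)
  simp only [Set.preimage_univ, measure_univ, Finset.prod_const_one, one_mul, Set.iInter_univ,
    Set.univ_inter] at h
  exact h

/-- The kinds of the successive arrivals are independent. -/
lemma iIndepFun_firstKind_iterate (hlam : 0 < lam) (hr : 0 < r) :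
    iIndepFun (fun n q => firstKind (residual^[n] q)) (gapLaw lam r) := by
  classical
  have := isProbabilityMeasure_gapLaw hlam hr
  rw [iIndepFun_iff_measure_inter_preimage_eq_mul]
  intro S sets _
  -- An arbitrary finite index set is filled up to an initial segment with trivial constraints.
  have h := gapLaw_iterate hlam hr (fun k => if k ∈ S then sets k else Set.univ) (S.sup id + 1)
    MeasurableSet.univ
  have hS : ∀ k ∈ S, k < S.sup id + 1 := fun k hk => Nat.lt_succ_of_le (Finset.le_sup (f := id) hk)
  have hset : (⋂ k ∈ Finset.range (S.sup id + 1), (fun q => firstKind (residual^[k] q)) ⁻¹'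
      (if k ∈ S then sets k else Set.univ)) =
      ⋂ k ∈ S, (fun q => firstKind (residual^[k] q)) ⁻¹' sets k := by
    ext q
    simp only [Set.mem_iInter, Finset.mem_range, Set.mem_preimage]
    constructor
    · intro h k hk
      have := h k (hS k hk)
      rwa [if_pos hk] at this
    · intro h k _
      split_ifs with hk
      · exact h k hk
      · trivial
  rw [Set.preimage_univ, Set.inter_univ, measure_univ, mul_one, hset] at h
  rw [h]
  have hsub : S ⊆ Finset.range (S.sup id + 1) := fun k hk => Finset.mem_range.2 (hS k hk)
  rw [← Finset.prod_subset hsub]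
  · refine Finset.prod_congr rfl fun k hk => ?_
    rw [if_pos hk, gapLaw_preimage_firstKind_iterate hlam hr]
  · intro k _ hk
    rw [if_neg hk, Set.preimage_univ, measure_univ]

lemma gapLaw_real_firstKind_true (hlam : 0 < lam) (hr : 0 < r) (n : ℕ) :
    (gapLaw lam r).real ((fun q => firstKind (residual^[n] q)) ⁻¹' {true}) = lam / (lam + r) := by
  have := isProbabilityMeasure_gapLaw hlam hr
  have h1 := gapLaw_firstKind_true hlam hr MeasurableSet.univ
  rw [Set.preimage_univ, Set.inter_univ, measure_univ, mul_one] at h1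
  rw [measureReal_def, gapLaw_preimage_firstKind_iterate hlam hr, h1,
    ENNReal.toReal_ofReal (by positivity)]

end Residual

/-! ### Sample paths of two independent Poisson processes -/

section SamplePath

/-- The gaps of a sequence of arrival times. -/
def gapSeq (s : ℕ → ℝ) : ℕ → ℝ
  | 0 => s 0
  | n + 1 => s (n + 1) - s n

lemma sum_gapSeq (s : ℕ → ℝ) (n : ℕ) : ∑ k ∈ Finset.range (n + 1), gapSeq s k = s n := by
  induction n with
  | zero => simp [gapSeq]
  | succ n ih => rw [Finset.sum_range_succ, ih, gapSeq]; ring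

lemma strictMono_of_gapSeq_pos {s : ℕ → ℝ} (h : ∀ n, 0 < gapSeq s n) : StrictMono s :=
  strictMono_nat_of_lt_succ fun n => sub_pos.1 (h (n + 1))

variable {s e : ℕ → ℝ}

/-- Both residual clocks are measured from the same current time, which cancels in their difference.
Tracking this difference and the untouched later gaps is therefore enough to decide every
comparison. -/
lemma residual_iterate_gapSeq (n : ℕ) :
    (residual^[n] (gapSeq s, gapSeq e)).1 0 - (residual^[n] (gapSeq s, gapSeq e)).2 0 =
        s (counts s e n).1 - e (counts s e n).2 ∧
      (∀ j, (residual^[n] (gapSeq s, gapSeq e)).1 (j + 1) =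
        s ((counts s e n).1 + j + 1) - s ((counts s e n).1 + j)) ∧
      ∀ j, (residual^[n] (gapSeq s, gapSeq e)).2 (j + 1) =
        e ((counts s e n).2 + j + 1) - e ((counts s e n).2 + j) := by
  induction n with
  | zero => simp [counts, gapSeq]
  | succ n ih =>
    rw [Function.iterate_succ_apply', residual, counts]
    generalize residual^[n] (gapSeq s, gapSeq e) = q at ih ⊢
    generalize counts s e n = c at ih ⊢
    obtain ⟨h1, h2, h3⟩ := ih
    by_cases h : s c.1 ≤ e c.2
    · have h' : q.1 0 ≤ q.2 0 := by linarith
      simp only [if_pos h, if_pos h', tailSeq, consSeq]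
      have h20 := h2 0
      simp only [zero_add, add_zero] at h20
      refine ⟨by rw [zero_add]; linarith, fun j => ?_, h3⟩
      rw [h2 (j + 1), show c.1 + (j + 1) = c.1 + 1 + j by omega]
    · have h' : ¬ q.1 0 ≤ q.2 0 := by intro h'; apply h; linarith
      simp only [if_neg h, if_neg h', tailSeq, consSeq]
      have h30 := h3 0
      simp only [zero_add, add_zero] at h30
      refine ⟨by rw [zero_add]; linarith, h2, fun j => ?_⟩
      rw [h3 (j + 1), show c.2 + (j + 1) = c.2 + 1 + j by omega]

lemma kind_eq_firstKind (n : ℕ) :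
    kind s e n = firstKind (residual^[n] (gapSeq s, gapSeq e)) := by
  have h := (residual_iterate_gapSeq (s := s) (e := e) n).1
  rw [kind, firstKind, decide_eq_decide, IsStatus]
  constructor <;> intro h' <;> linarith

/-- The growth of the epochs of all arrivals, from the growth of the status arrival times and
the proportion of status arrivals. -/
lemma tendsto_eventTime_div (hs : Monotone s) (he : Monotone e) {a p : ℝ} (hp : 0 < p)
    (hsum : Tendsto (fun n : ℕ => (∑ k ∈ Finset.range n, gapSeq s k) / n) atTop (𝓝 a))
    (hcount : Tendsto (fun n : ℕ => ((counts s e n).1 : ℝ) / n) atTop (𝓝 p)) :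
    Tendsto (fun n : ℕ => eventTime s e n / n) atTop (𝓝 (a * p)) := by
  have htop : Tendsto (fun n => (counts s e n).1) atTop atTop := by
    rw [← tendsto_natCast_atTop_iff (R := ℝ)]
    refine (hcount.pos_mul_atTop hp tendsto_natCast_atTop_atTop).congr' ?_
    filter_upwards [eventually_gt_atTop 0] with n hn
    have : (n : ℝ) ≠ 0 := by positivity
    field_simp
  -- With `c` status arrivals among the first `n`, the epoch lies between `s (c - 1)` and `s c`,
  -- sums of `c` and `c + 1` gaps. Each bound over `n` is a mean gap times a ratio tending to `p`.
  have hlow := (hsum.comp htop).mul hcount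
  have hcount' : Tendsto (fun n : ℕ => (((counts s e n).1 + 1 : ℕ) : ℝ) / n) atTop (𝓝 p) := by
    have := hcount.add tendsto_one_div_atTop_nhds_zero_nat
    rw [add_zero] at this
    refine this.congr fun n => ?_
    push_cast
    ring
  have hup := (hsum.comp ((tendsto_add_atTop_nat 1).comp htop)).mul hcount'
  refine tendsto_of_tendsto_of_tendsto_of_le_of_le' hlow hup ?_ ?_
  · filter_upwards [htop.eventually_gt_atTop 0] with n hn
    have h := le_eventTime_of_lt hs he n ((counts s e n).1 - 1) (by omega)
    simp only [Function.comp]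
    have hne : ((counts s e n).1 : ℝ) ≠ 0 := by positivity
    rw [div_mul_div_cancel₀ hne]
    refine div_le_div_of_nonneg_right ?_ (Nat.cast_nonneg n)
    rw [← sum_gapSeq s ((counts s e n).1 - 1), Nat.sub_add_cancel hn] at h
    exact h
  · refine Eventually.of_forall fun n => ?_
    simp only [Function.comp]
    have hne : (((counts s e n).1 + 1 : ℕ) : ℝ) ≠ 0 := by positivity
    rw [div_mul_div_cancel₀ hne, sum_gapSeq]
    exact div_le_div_of_nonneg_right (min_le_left _ _) (Nat.cast_nonneg n)

/-- The three rates, for a sample path with the typical long-run behaviour. -/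
lemma hasRate_of_typical {K B : ℕ} (hK : 1 ≤ K) (hB : 1 ≤ B) {lam r θ : ℝ} (hlam : 0 < lam)
    (hr : 0 < r) (hθ : lam = r * θ) (hθ1 : θ ≠ 1) {x₀ : SystemState} (hx₀ : IsStart K B x₀)
    (hs : StrictMono s) (hs0 : 0 < s 0) (he : Monotone e)
    (hsum : Tendsto (fun n : ℕ => (∑ k ∈ Finset.range n, gapSeq s k) / n) atTop (𝓝 (1 / lam)))
    (hex : ∀ z, Tendsto (fun n : ℕ => excess (lam / (lam + r))
      (level (K + B) (x₀.battery + K - x₀.buffer.length) (kind s e)) (kind s e) z n / n)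
      atTop (𝓝 0)) :
    HasRate (validCount K B x₀ s e) (lam * ((1 - θ ^ (K + B)) / (1 - θ ^ (K + B + 1)))) ∧
    HasRate (deliveredCount K B x₀ s e) (lam * ((1 - θ ^ (K + B)) / (1 - θ ^ (K + B + 1)))) ∧
    HasRate (admittedCount K B x₀ s e) (lam * ((1 - θ ^ (K + B)) / (1 - θ ^ (K + B + 1)))) := by
  classical
  rw [validCount_eq_deliveredCount hK hB hx₀ hs hs0]
  set z₀ := x₀.battery + K - x₀.buffer.length with hz₀def
  have hz₀ : z₀ ≤ K + B := by have := hx₀.battery_le; omega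
  have hp0 : 0 < lam / (lam + r) := by positivity
  have hp1 : lam / (lam + r) < 1 := by rw [div_lt_one (by positivity)]; linarith
  have hθ0 : 0 < θ := by
    by_contra! h
    nlinarith
  have hcount := tendsto_count_div hz₀ hex
  simp only [← counts_fst_eq_count] at hcount
  have htime := tendsto_eventTime_div hs.monotone he hp0 hsum hcount
  have hc : 1 / lam * (lam / (lam + r)) = 1 / (lam + r) := by field_simp
  rw [hc] at htime
  have hc0 : 0 < 1 / (lam + r) := by positivity
  have hratio : (1 - lam / (lam + r)) / (lam / (lam + r)) = θ⁻¹ := by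
    rw [hθ]; field_simp; ring
  have hdown := tendsto_count_down hp0 hz₀ hex hp1
  rw [hratio, one_sub_inv_geom_sum hθ0 hθ1] at hdown
  set α := lam / (lam + r) * ((1 - θ ^ (K + B)) / (1 - θ ^ (K + B + 1))) with hα
  have hrate : lam * ((1 - θ ^ (K + B)) / (1 - θ ^ (K + B + 1))) = α / (1 / (lam + r)) := by
    rw [hα]; field_simp
  rw [hrate]
  have hmono := monotone_eventTime hs.monotone he
  have hadm : Tendsto (fun n : ℕ => (Nat.count (fun k => IsStatus s e k ∧
      (state K B x₀ s e k).buffer.length < K) n : ℝ) / n) atTop (𝓝 α) := by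
    refine hdown.congr fun n => ?_
    simp only [kind_eq_true, buffer_length_lt_iff hK hB hx₀, hz₀def]
  have hdel : Tendsto (fun n : ℕ => (Nat.count (fun k => ∃ g, Delivers K B x₀ s e k g) n : ℝ) / n)
      atTop (𝓝 α) := by
    -- Deliveries equal admissions plus the initial buffer content minus the present one, a
    -- correction of size at most `K`.
    have hb : Tendsto (fun n : ℕ => ((x₀.buffer.length : ℝ)
        - (state K B x₀ s e n).buffer.length) / n) atTop (𝓝 0) := by
      have hK' := (tendsto_one_div_atTop_nhds_zero_nat (𝕜 := ℝ)).const_mul (K : ℝ)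
      rw [mul_zero] at hK'
      refine squeeze_zero_norm (fun n => ?_) hK'
      rw [norm_div, RCLike.norm_natCast, mul_one_div, Real.norm_eq_abs]
      refine div_le_div_of_nonneg_right ?_ (Nat.cast_nonneg n)
      have h1 : (x₀.buffer.length : ℝ) ≤ K := by exact_mod_cast hx₀.buffer_le
      have h2 : ((state K B x₀ s e n).buffer.length : ℝ) ≤ K := by
        exact_mod_cast (feasible_state hK hB hx₀ n).buffer_le
      rw [abs_le]
      constructor <;> linarith [(Nat.cast_nonneg x₀.buffer.length : (0 : ℝ) ≤ _),
        (Nat.cast_nonneg (state K B x₀ s e n).buffer.length : (0 : ℝ) ≤ _)]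
    have h := hadm.add hb
    rw [add_zero] at h
    refine h.congr fun n => ?_
    rw [← add_div]
    congr 1
    have h1 := waiting_add_received_eq_count (s := s) (e := e) hK hB hx₀ n
    rw [received_length_eq_count hK hB hx₀] at h1
    have h2 := congrArg (Nat.cast (R := ℝ)) h1
    push_cast at h2
    linarith
  exact ⟨hasRate_ncard hmono hc0 htime hdel, hasRate_ncard hmono hc0 htime hdel,
    hasRate_ncard hmono hc0 htime hadm⟩

end SamplePath

/-! ### Almost sure properties of the Poisson sample paths -/

section Poisson

lemma gap_eq_gapSeq {Ω : Type*} (T : ℕ → Ω → ℝ) (n : ℕ) (ω : Ω) :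
    gap T n ω = gapSeq (fun k => T k ω) n := by
  cases n <;> rfl

variable {Ω : Type*} [MeasurableSpace Ω] {P : Measure Ω} {rate : ℝ} {T : ℕ → Ω → ℝ}

lemma measurable_gapSeq : Measurable gapSeq := by
  refine measurable_pi_lambda _ fun n => ?_
  cases n with
  | zero => exact measurable_pi_apply 0
  | succ n => exact (measurable_pi_apply (n + 1)).sub (measurable_pi_apply n)

namespace IsPoissonArrivals

lemma measurable_gap (hT : IsPoissonArrivals P rate T) (n : ℕ) : Measurable (gap T n) := by
  cases n with
  | zero => exact hT.measurable 0
  | succ n => exact (hT.measurable (n + 1)).sub (hT.measurable n)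

lemma ae_gapSeq_pos (hT : IsPoissonArrivals P rate T) :
    ∀ᵐ ω ∂P, ∀ n, 0 < gapSeq (fun k => T k ω) n := by
  rw [ae_all_iff]
  intro n
  have h := ae_pos_expMeasure rate
  rw [← hT.law_gap n] at h
  filter_upwards [ae_of_ae_map (hT.measurable_gap n).aemeasurable h] with ω hω
  rwa [← gap_eq_gapSeq]

/-- The law of large numbers for the arrival times. -/
lemma ae_tendsto_sum_gapSeq (hT : IsPoissonArrivals P rate T) (hrate : 0 < rate) :
    ∀ᵐ ω ∂P, Tendsto (fun n : ℕ => (∑ k ∈ Finset.range n, gapSeq (fun k => T k ω) k) / n) atTop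
      (𝓝 (1 / rate)) := by
  have hm := (hT.measurable_gap 0).aemeasurable (μ := P)
  have hint : Integrable (gap T 0) P := by
    have h := integrable_id_expMeasure hrate
    rw [← hT.law_gap 0] at h
    exact h.comp_aemeasurable hm
  have hmean : ∫ ω, gap T 0 ω ∂P = 1 / rate := by
    rw [← integral_id_expMeasure hrate, ← hT.law_gap 0]
    exact (integral_map hm aestronglyMeasurable_id).symm
  have h := strong_law_ae_real (gap T) hint (fun i j hij => hT.indep_gap.indepFun hij)
    fun i => ⟨(hT.measurable_gap i).aemeasurable, hm, by rw [hT.law_gap, hT.law_gap]⟩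
  rw [hmean] at h
  simp only [gap_eq_gapSeq] at h
  exact h

lemma map_gapSeq (hT : IsPoissonArrivals P rate T) :
    P.map (fun ω => gapSeq fun n => T n ω) = Measure.infinitePi fun _ : ℕ => expMeasure rate := by
  have h := hT.indep_gap.map_fun_eq_infinitePi_map hT.measurable_gap
  simp only [hT.law_gap] at h
  rw [← h]
  congr 1
  funext ω n
  exact (gap_eq_gapSeq T n ω).symm

lemma measurable_path (hT : IsPoissonArrivals P rate T) : Measurable fun ω n => T n ω :=
  measurable_pi_lambda _ hT.measurable

end IsPoissonArrivals

lemma map_gapSeq_prod [IsProbabilityMeasure P] {lam r : ℝ} {S E : ℕ → Ω → ℝ}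
    (hS : IsPoissonArrivals P lam S) (hE : IsPoissonArrivals P r E)
    (hSE : IndepFun (fun ω n => S n ω) (fun ω n => E n ω) P) :
    P.map (fun ω => (gapSeq fun n => S n ω, gapSeq fun n => E n ω)) = gapLaw lam r := by
  have h := hSE.comp measurable_gapSeq measurable_gapSeq
  rw [gapLaw, ← hS.map_gapSeq, ← hE.map_gapSeq]
  exact h.map_prod_eq_prod_map_map (measurable_gapSeq.comp hS.measurable_path).aemeasurable
    (measurable_gapSeq.comp hE.measurable_path).aemeasurable

/-- The law of large numbers is proved on the space of gap sequences, where the residual map acts,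
and transported along the joint law of the gaps. -/
lemma ae_tendsto_excess_kind [IsProbabilityMeasure P] {lam r : ℝ} (hlam : 0 < lam) (hr : 0 < r)
    {S E : ℕ → Ω → ℝ} (hS : IsPoissonArrivals P lam S) (hE : IsPoissonArrivals P r E)
    (hSE : IndepFun (fun ω n => S n ω) (fun ω n => E n ω) P) (m z₀ : ℕ) :
    ∀ᵐ ω ∂P, ∀ z, Tendsto (fun n : ℕ => excess (lam / (lam + r))
      (level m z₀ (kind (fun n => S n ω) fun n => E n ω)) (kind (fun n => S n ω) fun n => E n ω)
      z n / n) atTop (𝓝 0) := by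
  rw [ae_all_iff]
  intro z
  have := isProbabilityMeasure_gapLaw hlam hr
  have hmeas : ∀ n, Measurable fun q => firstKind (residual^[n] q) := fun n =>
    measurable_firstKind.comp (measurable_residual.iterate n)
  have h := ae_tendsto_excess_div hmeas (iIndepFun_firstKind_iterate hlam hr)
    (gapLaw_real_firstKind_true hlam hr) m z₀ z
  rw [← map_gapSeq_prod hS hE hSE] at h
  have hm : Measurable fun ω => (gapSeq fun n => S n ω, gapSeq fun n => E n ω) :=
    (measurable_gapSeq.comp hS.measurable_path).prodMk (measurable_gapSeq.comp hE.measurable_path)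
  filter_upwards [ae_of_ae_map hm.aemeasurable h] with ω hω
  simp only [← kind_eq_firstKind] at hω
  exact hω

end Poisson

end StatusUpdate

theorem lemma1 {Ω : Type*} [MeasurableSpace Ω] (P : Measure Ω) [IsProbabilityMeasure P]
    (K B : ℕ) (hK : 1 ≤ K) (hB : 1 ≤ B)
    (lam r θ : ℝ) (hlam : 0 < lam) (hr : 0 < r) (hθ : lam = r * θ) (hθ1 : θ ≠ 1)
    (S E : ℕ → Ω → ℝ)
    (hS : StatusUpdate.IsPoissonArrivals P lam S)
    (hE : StatusUpdate.IsPoissonArrivals P r E)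
    (hSE : IndepFun (fun ω n => S n ω) (fun ω n => E n ω) P)
    (x₀ : StatusUpdate.SystemState) (hx₀ : StatusUpdate.IsStart K B x₀) :
    ∀ᵐ ω ∂P,
      StatusUpdate.HasRate
        (StatusUpdate.validCount K B x₀ (fun n => S n ω) (fun n => E n ω))
        (lam * ((1 - θ ^ (K + B)) / (1 - θ ^ (K + B + 1)))) ∧
      StatusUpdate.HasRate
        (StatusUpdate.deliveredCount K B x₀ (fun n => S n ω) (fun n => E n ω))
        (lam * ((1 - θ ^ (K + B)) / (1 - θ ^ (K + B + 1)))) ∧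
      StatusUpdate.HasRate
        (StatusUpdate.admittedCount K B x₀ (fun n => S n ω) (fun n => E n ω))
        (lam * ((1 - θ ^ (K + B)) / (1 - θ ^ (K + B + 1)))) := by
  -- These four almost sure properties are all the probability that is needed; the rest is
  -- deterministic.
  filter_upwards [hS.ae_gapSeq_pos, hE.ae_gapSeq_pos, hS.ae_tendsto_sum_gapSeq hlam,
    StatusUpdate.ae_tendsto_excess_kind hlam hr hS hE hSE (K + B)
      (x₀.battery + K - x₀.buffer.length)] with ω h1 h2 h3 h4
  exact StatusUpdate.hasRate_of_typical hK hB hlam hr hθ hθ1 hx₀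
    (StatusUpdate.strictMono_of_gapSeq_pos h1) (h1 0)
    (StatusUpdate.strictMono_of_gapSeq_pos h2).monotone h3 h4
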